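/- Let $X$ be a finite topological quandle, i.e. a finite set with a topology and a continuous operation $\triangleright : X\times X\to X$ such that $x\triangleright x=x$, $(x\triangleright y)\triangleright z=(x\triangleright z)\triangleright(y\triangleright z)$, and every map $\beta_y(x)=x\triangleright y$ is a homeomorphism. Let $A$ be a multiplicative abelian group. Let $C_n(X)$ be the free abelian group on the continuous maps $\sigma:\Delta^n\to X$, with boundary $$\partial\sigma_{[x_1,\dots,x_{n+1}]}=\sum_{i=2}^{n+1}(-1)^i\bigl(\sigma_{[x_1,\dots,\hat{x_i},\dots,x_{n+1}]}-\sigma_{[x_1,\dots,\hat{x_i},\dots,x_{n+1}]}\triangleright\sigma_{[x_i,\dots,x_i,\hat{x_i},x_{i+1},\dots,x_{n+1}]}\bigr),$$ where $x_1,\dots,x_{n+1}$ are the images of the vertices, the simplices on the right are the evident affine restrictions of $\sigma$, and $\triangleright$ is taken pointwise. Let $\bar C_n^Q(X)$ be the quotient of $C_n(X)$ by the differences of simplices with the same vertices and by the simplices with $x_i=x_{i+1}$ for some $i$. Let $\bar Z^1_Q(X,A)$ be the group of homomorphisms $\phi:\bar C_1^Q(X)\to A$ that vanish on $\partial C_2(X)$.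 For $x,y$ in one path component, $\sigma_{[x,y]}\in\bar C^Q_1(X)$ denotes the class of any path from $x$ to $y$. Let $D$ be an oriented link diagram. For a path component $X_\alpha$ of $X$, a coloring $\mathfrak C$ of $D$ by $X_\alpha$ assigns an element of $X_\alpha$ to every arc, such that at every crossing with over arc $r$ and under arcs $r_1,r_2$, where the normal vector of $r$ (to the left of its direction) points from $r_1$ to $r_2$, one has $\mathfrak C(r_2)=\mathfrak C(r_1)\triangleright\mathfrak C(r)$. The weight of such a crossing $\theta$ is $B(\theta,\mathfrak C)=\phi(\sigma_{[x,y]})^{\varepsilon(\theta)}$ with $x=\mathfrak C(r_1)$, $y=\mathfrak C(r)$ and $\varepsilon(\theta)=\pm1$ the sign of $\theta$. The partition function (state sum) of $D$ associated to $\phi\in\bar Z^1_Q(X,A)$ is $$\Phi_\phi(D)=\sum_\alpha\ \sum_{\mathfrak C \text{ coloring of } D \text{ by } X_\alpha}\ \prod_\theta B(\theta,\mathfrak C)\ \in\ \mathbb Z[A].$$ **Proposition.** Let $\phi\in\bar Z^1_Q(X,A)$. Then $\Phi_\phi$ is an invariant of oriented links, in particular of oriented knots: if two oriented link diagrams $D$,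 $D'$ are connected by a finite sequence of Reidemeister moves (of all three types, with all orientations and signs, in both directions), then $\Phi_\phi(D)=\Phi_\phi(D')$. -/

import Mathlib

/-! ## Topological quandles -/

/-- The right-handed quandle operation `x ▷ y`: the point `y` acts on `x`.
Mathlib writes the acting element on the left. -/
def qop {X : Type*} [Shelf X] (x y : X) : X := Shelf.act y x

/-- A topological quandle: the operation is continuous and every right translation
`β_y : x ↦ x ▷ y` is a homeomorphism. -/
class IsTopologicalQuandle (X : Type*) [TopologicalSpace X] [Quandle X] : Prop where
  continuous_qop : Continuous fun p : X × X => qop p.1 p.2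
  isHomeomorph_qop : ∀ y : X, IsHomeomorph fun x : X => qop x y

/-! ## Chains and cochains of a topological quandle -/

/-- Singular `n`-simplices of `X`. -/
abbrev SingularSimplex (X : Type*) [TopologicalSpace X] (n : ℕ) : Type _ :=
  C(stdSimplex ℝ (Fin (n + 1)), X)

namespace SingularSimplex

/-- The image of the `i`-th vertex. -/
def vertex {X : Type*} [TopologicalSpace X] {n : ℕ} (s : SingularSimplex X n)
    (i : Fin (n + 1)) : X :=
  s (stdSimplex.vertex i)

/-- Precomposition with the affine map of standard simplices given by a map of vertices. -/
noncomputable def reindex {X : Type*} [TopologicalSpace X] {m n : ℕ}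
    (s : SingularSimplex X n) (f : Fin (m + 1) → Fin (n + 1)) : SingularSimplex X m :=
  s.comp ⟨stdSimplex.map f, stdSimplex.continuous_map f⟩

/-- The face of `s` opposite to the vertex `j`. -/
noncomputable def face {X : Type*} [TopologicalSpace X] {n : ℕ}
    (s : SingularSimplex X (n + 1)) (j : Fin (n + 2)) : SingularSimplex X n :=
  s.reindex j.succAbove

/-- The simplex `[x_j, …, x_j, x_{j+1}, …, x_{n+1}]` obtained from `s = [x_0, …, x_{n+1}]`:
the first `j` vertices are sent to the vertex `j`, the remaining ones to the vertices
`j + 1, …, n + 1`. -/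
noncomputable def actingFace {X : Type*} [TopologicalSpace X] {n : ℕ}
    (s : SingularSimplex X (n + 1)) (j : Fin (n + 2)) : SingularSimplex X n :=
  s.reindex fun m : Fin (n + 1) => if m.castSucc < j then j else m.succ

/-- The pointwise quandle operation on singular simplices. -/
def op {X : Type*} [TopologicalSpace X] [Quandle X] [IsTopologicalQuandle X] {n : ℕ}
    (s t : SingularSimplex X n) : SingularSimplex X n :=
  ⟨fun p => qop (s p) (t p),
    IsTopologicalQuandle.continuous_qop.comp (s.continuous.prodMk t.continuous)⟩

end SingularSimplex

/-- The group `C_n(X)` of singular `n`-chains. -/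
abbrev QChain (X : Type*) [TopologicalSpace X] (n : ℕ) : Type _ :=
  FreeAbelianGroup (SingularSimplex X n)

/-- The boundary map `∂ : C_{n+1}(X) → C_n(X)`. With vertices counted from `0`, the sum is over
all vertices except the initial one; the vertex `k + 1` carries the sign `(-1)^k`. -/
noncomputable def qBoundary (X : Type*) [TopologicalSpace X] [Quandle X]
    [IsTopologicalQuandle X] (n : ℕ) : QChain X (n + 1) →+ QChain X n :=
  FreeAbelianGroup.lift fun s : SingularSimplex X (n + 1) =>
    ∑ k : Fin (n + 1), (-1 : ℤ) ^ (k : ℕ) •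
      (FreeAbelianGroup.of (s.face k.succ) -
        FreeAbelianGroup.of ((s.face k.succ).op (s.actingFace k.succ)))

/-- The subgroup of `C_n(X)` divided out in `C̄_n^Q(X)`: it is generated by the differences of
simplices with the same vertices, and by the simplices with two equal consecutive vertices. -/
def qRelations (X : Type*) [TopologicalSpace X] (n : ℕ) : AddSubgroup (QChain X n) :=
  AddSubgroup.closure
    ({c | ∃ s t : SingularSimplex X n, (∀ i, s.vertex i = t.vertex i) ∧
        c = FreeAbelianGroup.of s - FreeAbelianGroup.of t} ∪
      {c | ∃ s : SingularSimplex X n, (∃ i : Fin n, s.vertex i.castSucc = s.vertex i.succ) ∧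
        c = FreeAbelianGroup.of s})

/-- The quandle chain group `C̄_n^Q(X)`. -/
abbrev QBarChain (X : Type*) [TopologicalSpace X] (n : ℕ) : Type _ :=
  QChain X n ⧸ qRelations X n

/-- The class in `C̄_n^Q(X)` of a singular chain. -/
def QBarChain.mk {X : Type*} [TopologicalSpace X] {n : ℕ} : QChain X n →+ QBarChain X n :=
  QuotientAddGroup.mk' (qRelations X n)

/-- The group `Z̄^n_Q(X, A)` of quandle `n`-cocycles with values in the multiplicative abelian
group `A`: the homomorphisms `C̄_n^Q(X) → A` that are trivial on boundaries of `(n+1)`-chains. -/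
def QCocycle (X A : Type*) [TopologicalSpace X] [Quandle X] [IsTopologicalQuandle X]
    [CommGroup A] (n : ℕ) : AddSubgroup (QBarChain X n →+ Additive A) where
  carrier := {φ | ∀ c : QChain X (n + 1), φ (QBarChain.mk (qBoundary X n c)) = 0}
  add_mem' := fun {φ ψ} hφ hψ c => by
    rw [AddMonoidHom.add_apply, hφ c, hψ c, add_zero]
  zero_mem' := fun _ => rfl
  neg_mem' := fun {φ} hφ c => by
    rw [AddMonoidHom.neg_apply, hφ c, neg_zero]

/-- Points in the same path component are the vertices of a singular `1`-simplex. -/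
theorem exists_simplex_of_joined {X : Type*} [TopologicalSpace X] {x y : X} (h : Joined x y) :
    ∃ s : SingularSimplex X 1, s.vertex 0 = x ∧ s.vertex 1 = y := by
  refine ⟨h.somePath.toContinuousMap.comp
    ⟨stdSimplexHomeomorphUnitInterval, stdSimplexHomeomorphUnitInterval.continuous⟩, ?_, ?_⟩
  · exact h.somePath.source
  · exact h.somePath.target

/-- The generator `σ_[x, y]` of `C̄_1^Q(X)`: the class of any path from `x` to `y`. -/
noncomputable def edgeClass {X : Type*} [TopologicalSpace X] {x y : X} (h : Joined x y) :
    QBarChain X 1 :=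
  QBarChain.mk (FreeAbelianGroup.of (exists_simplex_of_joined h).choose)

/-- `edgeClass` does not depend on the chosen path. -/
theorem edgeClass_eq {X : Type*} [TopologicalSpace X] {x y : X} (h : Joined x y)
    (s : SingularSimplex X 1) (hx : s.vertex 0 = x) (hy : s.vertex 1 = y) :
    edgeClass h = QBarChain.mk (FreeAbelianGroup.of s) := by
  have hc := (exists_simplex_of_joined h).choose_spec
  refine (QuotientAddGroup.eq_iff_sub_mem).2 (AddSubgroup.subset_closure (Or.inl ?_))
  refine ⟨_, s, fun i => ?_, rfl⟩
  fin_cases i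
  · exact hc.1.trans hx.symm
  · exact hc.2.trans hy.symm

/-! ## Oriented link diagrams -/

/-- The two strands passing through a crossing. -/
inductive Strand : Type
  | over : Strand
  | under : Strand

instance : Finite Strand :=
  Finite.of_surjective (fun b : Bool => if b then Strand.over else Strand.under) fun s => by
    cases s
    · exact ⟨true, rfl⟩
    · exact ⟨false, rfl⟩

/-- A signed oriented Gauss diagram of a link. Every crossing `c` is passed twice, by its over
strand `(c, over)` and by its under strand `(c, under)`; travelling along the link in the direction
of its orientation, the passage that follows `v` is `next v`. Hence the link components that
pass through crossings are the cycles of `next`; there are `loops` further components without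
crossings. -/
structure GaussDiagram : Type 1 where
  Crossing : Type
  fintypeCrossing : Fintype Crossing
  sign : Crossing → ℤˣ
  next : Equiv.Perm (Crossing × Strand)
  loops : ℕ

attribute [instance] GaussDiagram.fintypeCrossing

namespace GaussDiagram

/-- Passages through crossings. They also label the semi-arcs (edges) of the diagram that are not
free loops: `v` labels the semi-arc that leaves the crossing along the passage `v` and leads
to the passage `next v`. -/
abbrev Passage (D : GaussDiagram) : Type := D.Crossing × Strand

/-- The semi-arc that arrives at the passage `v`. -/
def incoming (D : GaussDiagram) (v : D.Passage) : D.Passage := D.next.symm v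

/-- The semi-arc that leaves from the passage `v`. -/
def outgoing (D : GaussDiagram) (v : D.Passage) : D.Passage := v

/-- The half-edges at the crossings: `(v, true)` is the outgoing and `(v, false)` the incoming
half-edge of the passage `v`. -/
abbrev HalfEdge (D : GaussDiagram) : Type := D.Passage × Bool

/-- The other half of the same semi-arc. -/
def opposite (D : GaussDiagram) : D.HalfEdge → D.HalfEdge
  | (v, true) => (D.next v, false)
  | (v, false) => (D.next.symm v, true)

/-- The next half-edge at the same crossing in counterclockwise order. At a positive crossing
the counterclockwise order is over-out, under-out, over-in, under-in; at a negative crossing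
it is over-out, under-in, over-in, under-out. -/
def rotate (D : GaussDiagram) : D.HalfEdge → D.HalfEdge
  | ((c, Strand.over), b) => ((c, Strand.under), if D.sign c = 1 then b else !b)
  | ((c, Strand.under), b) => ((c, Strand.over), if D.sign c = 1 then !b else b)

/-- The pieces of the underlying 4-valent graph. -/
def Piece (D : GaussDiagram) : Type :=
  Quot fun c d : D.Crossing => ∃ s t : Strand, D.next (c, s) = (d, t)

/-- The boundary circuits of the regions of the underlying graph, embedded with the cyclic orders
`rotate` in a closed oriented surface, one component for each piece. -/
def Face (D : GaussDiagram) : Type :=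
  Quot fun h k : D.HalfEdge => D.rotate (D.opposite h) = k

/-- The diagram can be drawn on the sphere, equivalently in the plane, without further crossings:
every piece has Euler characteristic `2`. The number of edges is twice that of the crossings. -/
def IsPlanar (D : GaussDiagram) : Prop :=
  Nat.card D.Crossing + Nat.card D.Face = 2 * Nat.card D.Crossing + 2 * Nat.card D.Piece

/-- The link components of `D` that pass through some crossing. -/
def Cycle (D : GaussDiagram) : Type :=
  Quotient (Equiv.Perm.SameCycle.setoid D.next)

/-- The diagram `D'` arises from `D` by erasing the crossings in `S`; the map `f` embeds the
crossings of `D'` as those of `D` outside `S`. The order of the remaining passages is the one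
inherited from `D`, and components of `D` that pass only through crossings in `S` become
loops without crossings. -/
structure IsErasure (D D' : GaussDiagram) (S : Set D.Crossing)
    (f : D'.Crossing → D.Crossing) : Prop where
  injective : Function.Injective f
  range_eq : Set.range f = Sᶜ
  sign_eq : ∀ c, D.sign (f c) = D'.sign c
  next_eq : ∀ v : D'.Passage, ∃ n : ℕ,
    (D.next ^ (n + 1)) (f v.1, v.2) = (f (D'.next v).1, (D'.next v).2) ∧
      ∀ k < n, ((D.next ^ (k + 1)) (f v.1, v.2)).1 ∈ S
  loops_eq : D'.loops = D.loops +
    Nat.card {q : D.Cycle // ∀ v : D.Passage, Quotient.mk _ v = q → v.1 ∈ S}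

/-- `D` and `D'` differ by renaming crossings. -/
def IsRelabeling (D D' : GaussDiagram) : Prop :=
  ∃ e : D.Crossing ≃ D'.Crossing, (∀ c, D'.sign (e c) = D.sign c) ∧
    (∀ v : D.Passage, D'.next (e v.1, v.2) = (e (D.next v).1, (D.next v).2)) ∧
    D'.loops = D.loops

/-- First Reidemeister move, removing a kink: one strand of the crossing `c` leads directly to
the other one. All four kinds of kinks are allowed. -/
def IsMove₁ (D D' : GaussDiagram) : Prop :=
  ∃ c : D.Crossing,
    (D.next (c, Strand.over) = (c, Strand.under) ∨
      D.next (c, Strand.under) = (c, Strand.over)) ∧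
    ∃ f, IsErasure D D' {c} f

/-- Second Reidemeister move, removing a bigon: the crossings `c` and `d` have opposite signs,
the over strand runs directly from `c` to `d`, and the under strand runs directly from `c` to `d`
(parallel strands) or from `d` to `c` (antiparallel strands). -/
def IsMove₂ (D D' : GaussDiagram) : Prop :=
  ∃ c d : D.Crossing, c ≠ d ∧ D.sign d = -D.sign c ∧
    D.next (c, Strand.over) = (d, Strand.over) ∧
    (D.next (c, Strand.under) = (d, Strand.under) ∨
      D.next (d, Strand.under) = (c, Strand.under)) ∧
    ∃ f, IsErasure D D' {c, d} f

/-- The passage `v` leads directly to `w` if `ε = 1`, and `w` leads directly to `v` if `ε = -1`. -/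
def Adjacent (D : GaussDiagram) (ε : ℤˣ) (v w : D.Passage) : Prop :=
  if ε = 1 then D.next v = w else D.next w = v

/-- The passages of a triangle are exchanged in pairs: for crossings `a` (top over middle strand),
`b` (top over bottom strand) and `c` (middle over bottom strand), the two passages of the top
strand, of the middle strand and of the bottom strand. -/
noncomputable def triangleSwap (D : GaussDiagram) (a b c : D.Crossing) : Equiv.Perm D.Passage :=
  open Classical in
  Equiv.swap (a, Strand.over) (b, Strand.over) *
    Equiv.swap (a, Strand.under) (c, Strand.over) *
    Equiv.swap (b, Strand.under) (c, Strand.under)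

/-- Third Reidemeister move, for all orientations of the three strands. The crossings `a`, `b`, `c`
are those of top over middle, top over bottom and middle over bottom strand. Each strand runs
directly between its two crossings. The condition relating the directions of the strands
to the signs says that the three semi-arcs bound a triangle: if the crossings are the vertices
of a triangle of directed lines, with `λ, μ, ν` the signs of the directions from `a` to `b`, from
`a` to `c` and from `b` to `c`, then `(λ, μ, ν) = ± (sign c, sign b, sign a)`. The move moves one
strand across the crossing of the other two, which reverses the order of the two crossings on
each strand. -/
def IsMove₃ (D D' : GaussDiagram) : Prop :=
  ∃ (a b c : D.Crossing) (η : ℤˣ), a ≠ b ∧ a ≠ c ∧ b ≠ c ∧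
    D.Adjacent (η * D.sign c) (a, Strand.over) (b, Strand.over) ∧
    D.Adjacent (η * D.sign b) (a, Strand.under) (c, Strand.over) ∧
    D.Adjacent (η * D.sign a) (b, Strand.under) (c, Strand.under) ∧
    ∃ e : D.Crossing ≃ D'.Crossing, (∀ x, D'.sign (e x) = D.sign x) ∧
      (∀ v w : D.Passage, D.next v = w →
        D'.next (e (D.triangleSwap a b c v).1, (D.triangleSwap a b c v).2) =
          (e (D.triangleSwap a b c w).1, (D.triangleSwap a b c w).2)) ∧
      D'.loops = D.loops

end GaussDiagram

/-- Oriented link diagrams (up to isotopy on the sphere), given by planar Gauss diagrams. -/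
structure LinkDiagram : Type 1 extends GaussDiagram where
  isPlanar : toGaussDiagram.IsPlanar

namespace LinkDiagram

/-- Two link diagrams differ by a renaming of crossings or by one Reidemeister move. -/
inductive Move (D D' : LinkDiagram) : Prop
  | relabeling : D.IsRelabeling D'.toGaussDiagram → Move D D'
  | reidemeister₁ : D.IsMove₁ D'.toGaussDiagram → Move D D'
  | reidemeister₂ : D.IsMove₂ D'.toGaussDiagram → Move D D'
  | reidemeister₃ : D.IsMove₃ D'.toGaussDiagram → Move D D'

/-- Two diagrams represent the same oriented link: they are connected by a finite sequence of
Reidemeister moves and their inverses. -/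
def SameLink (D D' : LinkDiagram) : Prop := Relation.EqvGen Move D D'

end LinkDiagram

/-! ## Colorings and the state sum -/

namespace GaussDiagram

/-- A coloring of the diagram `D` by the path component `α` of `X`. A color is given to every
semi-arc and to every loop without crossings; the two semi-arcs at an over strand belong to the
same arc. At a crossing with over color `y`, the under arcs `r₁`, `r₂` satisfy
`color r₂ = color r₁ ▷ y`, where the normal vector of the over arc (to the left of its direction)
points from `r₁` to `r₂`: thus `r₁` is the incoming under arc at a positive crossing and the outgoing
one at a negative crossing. -/
structure Coloring (D : GaussDiagram) {X : Type*} [TopologicalSpace X] [Quandle X]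
    (α : ZerothHomotopy X) where
  color : D.Passage → X
  loopColor : Fin D.loops → X
  color_mem : ∀ v, (Quotient.mk _ (color v) : ZerothHomotopy X) = α
  loopColor_mem : ∀ i, (Quotient.mk _ (loopColor i) : ZerothHomotopy X) = α
  over_eq : ∀ c, color (D.outgoing (c, Strand.over)) = color (D.incoming (c, Strand.over))
  under_pos : ∀ c, D.sign c = 1 → color (D.outgoing (c, Strand.under)) =
    qop (color (D.incoming (c, Strand.under))) (color (D.outgoing (c, Strand.over)))
  under_neg : ∀ c, D.sign c = -1 → color (D.incoming (c, Strand.under)) =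
    qop (color (D.outgoing (c, Strand.under))) (color (D.outgoing (c, Strand.over)))

namespace Coloring

/-- The color of the over arc at the crossing `c`. -/
def overColor {D : GaussDiagram} {X : Type*} [TopologicalSpace X] [Quandle X]
    {α : ZerothHomotopy X} (C : D.Coloring α) (c : D.Crossing) : X :=
  C.color (D.outgoing (c, Strand.over))

/-- The color of the under arc from which the normal vector of the over arc points away. -/
def sourceColor {D : GaussDiagram} {X : Type*} [TopologicalSpace X] [Quandle X]
    {α : ZerothHomotopy X} (C : D.Coloring α) (c : D.Crossing) : X :=
  C.color (if D.sign c = 1 then D.incoming (c, Strand.under) else D.outgoing (c, Strand.under))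

theorem joined {D : GaussDiagram} {X : Type*} [TopologicalSpace X] [Quandle X]
    {α : ZerothHomotopy X} (C : D.Coloring α) (c : D.Crossing) :
    Joined (C.sourceColor c) (C.overColor c) :=
  Quotient.exact ((C.color_mem _).trans (C.color_mem _).symm)

/-- The weight `φ(σ_[x, y])^ε` at the crossing `c`. -/
noncomputable def weight {D : GaussDiagram} {X A : Type*} [TopologicalSpace X] [Quandle X]
    [IsTopologicalQuandle X] [CommGroup A] {α : ZerothHomotopy X}
    (φ : QCocycle X A 1) (C : D.Coloring α) (c : D.Crossing) : A :=
  (Additive.toMul (φ.1 (edgeClass (C.joined c)))) ^ ((D.sign c : ℤˣ) : ℤ)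

/-- A finite quandle gives finitely many colorings. -/
instance instFinite {D : GaussDiagram} {X : Type*} [Finite X] [TopologicalSpace X] [Quandle X]
    {α : ZerothHomotopy X} : Finite (D.Coloring α) :=
  Finite.of_injective (fun C : D.Coloring α => (C.color, C.loopColor)) fun C C' h => by
    cases C
    cases C'
    simp only [Prod.mk.injEq] at h
    obtain ⟨rfl, rfl⟩ := h
    rfl

end Coloring

end GaussDiagram

/-- There are finitely many path components. -/
instance {X : Type*} [Finite X] [TopologicalSpace X] : Finite (ZerothHomotopy X) :=
  Quotient.finite _

/-- The state sum (partition function) of the diagram `D`: the sum, in the group ring `ℤ[A]`, over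
all path components and all colorings of `D` by that component, of the products of the weights of
all crossings. -/
noncomputable def stateSum {X A : Type*} [Finite X] [TopologicalSpace X] [Quandle X]
    [IsTopologicalQuandle X] [CommGroup A] (φ : QCocycle X A 1) (D : LinkDiagram) :
    MonoidAlgebra ℤ A :=
  ∑ᶠ α : ZerothHomotopy X, ∑ᶠ C : D.Coloring α,
    MonoidAlgebra.of ℤ A (∏ c : D.Crossing, C.weight φ c)

/-! ## Finite sums along a one-to-one relation -/

/-! On a path component `α` put `w x y = φ(σ_[x,y])`. Since `β_y` is a homeomorphism that fixes `y`,
path components are subquandles, and `w` is an ordinary quandle 2-cocycle there: degenerate edges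
give `w x x = 1`, and the boundary of a 2-simplex with vertices `x`, `y`, `z` gives the cocycle
identity (`edgeWeight_isQuandleCocycle`). So `Φ_φ` is the sum over `α` of the usual cocycle state
sums, and it suffices that each Reidemeister move comes with a weight-preserving bijection of
colorings.

At a kink a strand passes under an arc of its own color, so its color is kept and the weight is a
power of `w x x = 1`. At a bigon the second crossing undoes the first, and the two weights are
inverse to each other. At a triangle self-distributivity matches the colorings
(`PassesUnder.exchange`), the top-middle crossing keeps its weight, and the product of the two
weights on the bottom strand is preserved by the cocycle identity (`IsQuandleCocycle.exchange`).

To separate this from bookkeeping, diagrams are replaced by wirings, which only record the edges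
entering and leaving each passage. The first two moves factor through `Wiring.throughSum`: colorings
of `D` are first matched with colorings that ignore the erased crossings, and these descend to `D'`
because erasure merges exactly the edges joined through erased passages (`IsErasure.throughSum_eq`).
The third move is carried out on a fixed set of edges, where only the colors of the inner middle and
inner bottom edges change. Describing each strand by its pair of ends in a chosen direction treats
all orientations and signs at once. -/

/-- The correspondences of colorings are naturally relations, such as agreement away from some
edges; existence and uniqueness on both sides make such a relation a bijection. -/
theorem finsum_eq_of_biUnique {I J M : Type*} [AddCommMonoid M] {F : I → M} {G : J → M}
    (R : I → J → Prop) (hl : ∀ i, ∃ j, R i j) (hr : ∀ j, ∃ i, R i j)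
    (ul : ∀ i j j', R i j → R i j' → j = j') (ur : ∀ i i' j, R i j → R i' j → i = i')
    (h : ∀ i j, R i j → F i = G j) : ∑ᶠ i, F i = ∑ᶠ j, G j := by
  choose e he using hl
  refine finsum_eq_of_bijective e ⟨fun i i' hi => ?_, fun j => ?_⟩ fun i => h i _ (he i)
  · exact ur i i' (e i) (he i) (hi ▸ he i')
  · obtain ⟨i, hi⟩ := hr j
    exact ⟨i, ul i _ _ (he i) hi⟩

/-! ## Quandle cocycles -/

section Algebra

variable {Y A : Type*} [Quandle Y] [CommGroup A]

@[simp]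
theorem qop_self (x : Y) : qop x x = x := Quandle.fix

theorem qop_qop (x y z : Y) : qop (qop x y) z = qop (qop x z) (qop y z) := Shelf.self_distrib

theorem qop_injective (y : Y) : Function.Injective fun x : Y => qop x y :=
  (Rack.act' y).injective

theorem qop_surjective (y : Y) : Function.Surjective fun x : Y => qop x y :=
  (Rack.act' y).surjective

theorem qop_left_inj {x x' y : Y} : qop x y = qop x' y ↔ x = x' := (qop_injective y).eq_iff

/-- A quandle `2`-cocycle with values in a multiplicative abelian group. -/
structure IsQuandleCocycle (w : Y → Y → A) : Prop where
  diag : ∀ x, w x x = 1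
  cocycle : ∀ x y z, w x z * w (qop x z) (qop y z) = w (qop x y) z * w x y

/-- Passing with sign `s` under an arc of color `y` changes the color `x` to `z`. -/
def PassesUnder (s : ℤˣ) (x z y : Y) : Prop := if s = 1 then z = qop x y else x = qop z y

/-- The color on the side of the over arc from which its normal vector points away. -/
def underSource {Z : Type*} (s : ℤˣ) (x z : Z) : Z := if s = 1 then x else z

theorem passesUnder_one {x z y : Y} : PassesUnder 1 x z y ↔ z = qop x y := by
  simp [PassesUnder]

theorem passesUnder_neg_one {x z y : Y} : PassesUnder (-1) x z y ↔ x = qop z y := by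
  simp [PassesUnder]

theorem passesUnder_neg {s : ℤˣ} {x z y : Y} : PassesUnder (-s) x z y ↔ PassesUnder s z x y := by
  obtain rfl | rfl := Int.units_eq_one_or s <;> simp [passesUnder_one, passesUnder_neg_one]

theorem underSource_neg {Z : Type*} (s : ℤˣ) (x z : Z) :
    underSource (-s) x z = underSource s z x := by
  obtain rfl | rfl := Int.units_eq_one_or s <;> simp [underSource]

theorem PassesUnder.exists (s : ℤˣ) (x y : Y) : ∃ z, PassesUnder s x z y := by
  obtain rfl | rfl := Int.units_eq_one_or s
  · exact ⟨_, passesUnder_one.2 rfl⟩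
  · obtain ⟨z, hz⟩ := qop_surjective y x
    exact ⟨z, passesUnder_neg_one.2 hz.symm⟩

theorem PassesUnder.unique {s : ℤˣ} {x z z' y : Y} (h : PassesUnder s x z y)
    (h' : PassesUnder s x z' y) : z = z' := by
  obtain rfl | rfl := Int.units_eq_one_or s
  · exact (passesUnder_one.1 h).trans (passesUnder_one.1 h').symm
  · exact qop_injective y ((passesUnder_neg_one.1 h).symm.trans (passesUnder_neg_one.1 h'))

/-- Idempotence, combined for `s = -1` with injectivity of the right translation; this is the
coloring condition at a kink. -/
theorem passesUnder_self_left {s : ℤˣ} {y z : Y} : PassesUnder s y z y ↔ z = y := by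
  obtain rfl | rfl := Int.units_eq_one_or s
  · rw [passesUnder_one, qop_self]
  · rw [passesUnder_neg_one]
    nth_rewrite 1 [← qop_self y]
    rw [qop_left_inj, eq_comm]

theorem passesUnder_self_right {s : ℤˣ} {y x : Y} : PassesUnder s x y y ↔ x = y := by
  rw [← passesUnder_neg, passesUnder_self_left]

/-- The colors of a strand that passes under two crossing strands, in the two possible orders. -/
theorem PassesUnder.exchange {p q : ℤˣ} {t m₀ m₁ b₀ b₁ b₁' b₂ : Y} (hm : PassesUnder p m₀ m₁ t)
    (h₁ : PassesUnder p b₀ b₁ t) (h₂ : PassesUnder q b₁ b₂ m₁) (h₁' : PassesUnder q b₀ b₁' m₀) :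
    PassesUnder p b₁' b₂ t := by
  -- In each sign case this is self-distributivity; when `q = -1` the translation by `m₁` or `m₀` is
  -- cancelled afterwards.
  obtain rfl | rfl := Int.units_eq_one_or p <;> obtain rfl | rfl := Int.units_eq_one_or q <;>
    simp only [passesUnder_one, passesUnder_neg_one] at *
  · subst_vars
    exact (qop_qop _ _ _).symm
  · subst hm h₁'
    rw [h₁, qop_qop, qop_left_inj] at h₂
    exact h₂.symm
  · subst_vars
    rw [← qop_qop]
  · subst hm h₂
    rw [h₁, qop_qop, qop_left_inj] at h₁'
    exact h₁'.symm

/-- The bottom strand passes under the top color `t` and under the middle strand, whose color is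
`m₀` or `m₁` on the two sides of `t`. Both exponents may be multiplied by `B`, so only their product
matters; by `hs` it is the product of the senses `p`, `q`, and each of the four cases is an instance
of the cocycle identity. -/
theorem IsQuandleCocycle.exchange {w : Y → Y → A} (hw : IsQuandleCocycle w) {p q B C : ℤˣ}
    (hs : B * C = p * q) {t m₀ m₁ b₀ b₁ b₁' b₂ : Y} (hm : PassesUnder p m₀ m₁ t)
    (h₁ : PassesUnder p b₀ b₁ t) (h₂ : PassesUnder q b₁ b₂ m₁) (h₁' : PassesUnder q b₀ b₁' m₀) :
    w (underSource p b₀ b₁) t ^ (B : ℤ) * w (underSource q b₁ b₂) m₁ ^ (C : ℤ) =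
      w (underSource p b₁' b₂) t ^ (B : ℤ) * w (underSource q b₀ b₁') m₀ ^ (C : ℤ) := by
  have h₂' := hm.exchange h₁ h₂ h₁'
  have hC : C = B * (p * q) := by rw [← hs, ← mul_assoc, Int.units_mul_self, one_mul]
  -- The case `B = 1`; the general identity is its `B`-th power.
  have key : w (underSource p b₀ b₁) t * w (underSource q b₁ b₂) m₁ ^ ((p * q : ℤˣ) : ℤ) =
      w (underSource p b₁' b₂) t * w (underSource q b₀ b₁') m₀ ^ ((p * q : ℤˣ) : ℤ) := by
    obtain rfl | rfl := Int.units_eq_one_or p <;> obtain rfl | rfl := Int.units_eq_one_or q <;>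
      simp only [passesUnder_one, passesUnder_neg_one] at * <;>
      simp [underSource]
    · subst_vars
      exact hw.cocycle _ _ _
    · subst h₁' hm h₂'
      rw [← div_eq_mul_inv, ← div_eq_mul_inv, div_eq_div_iff_mul_eq_mul, ← hw.cocycle]
    · subst h₁ hm h₂
      rw [← div_eq_mul_inv, ← div_eq_mul_inv, div_eq_div_iff_mul_eq_mul, hw.cocycle]
    · subst h₂' hm h₂
      exact (hw.cocycle _ _ _).symm
  rw [hC, Units.val_mul, mul_comm (B : ℤ), zpow_mul, zpow_mul, ← mul_zpow, ← mul_zpow, key]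

end Algebra

/-! ## State sums of abstract wirings -/

/-- Crossings `K` with signs, whose strands connect edges from a set `E`. -/
structure Wiring (K E : Type) where
  sign : K → ℤˣ
  inn : K × Strand → E
  out : K × Strand → E

namespace Wiring

variable {K E : Type} {Y A : Type*} [Quandle Y] [CommGroup A]

/-- The coloring condition at the crossing `c`. -/
def IsColoredAt (W : Wiring K E) (κ : E → Y) (c : K) : Prop :=
  κ (W.out (c, Strand.over)) = κ (W.inn (c, Strand.over)) ∧
    PassesUnder (W.sign c) (κ (W.inn (c, Strand.under))) (κ (W.out (c, Strand.under)))
      (κ (W.out (c, Strand.over)))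

/-- The Boltzmann weight of the crossing `c`. -/
def weight (W : Wiring K E) (w : Y → Y → A) (κ : E → Y) (c : K) : A :=
  w (underSource (W.sign c) (κ (W.inn (c, Strand.under))) (κ (W.out (c, Strand.under))))
    (κ (W.out (c, Strand.over))) ^ ((W.sign c : ℤˣ) : ℤ)

/-- The sum over all colorings of the products of the weights. -/
noncomputable def stateSum [Fintype K] (W : Wiring K E) (w : Y → Y → A) : MonoidAlgebra ℤ A :=
  ∑ᶠ κ : {κ : E → Y // ∀ c, W.IsColoredAt κ c}, MonoidAlgebra.of ℤ A (∏ c, W.weight w κ.1 c)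

theorem isColoredAt_iff_of_edges {K' E' : Type} {W : Wiring K E} {W' : Wiring K' E'} {c : K}
    {c' : K'} {κ : E → Y} {κ' : E' → Y} (hs : W.sign c = W'.sign c')
    (hi : ∀ s, κ (W.inn (c, s)) = κ' (W'.inn (c', s)))
    (ho : ∀ s, κ (W.out (c, s)) = κ' (W'.out (c', s))) :
    W.IsColoredAt κ c ↔ W'.IsColoredAt κ' c' := by
  simp only [IsColoredAt, hs, hi, ho]

theorem weight_eq_of_edges {K' E' : Type} {Z : Type*} {W : Wiring K E} {W' : Wiring K' E'} {c : K}
    {c' : K'} {κ : E → Z} {κ' : E' → Z} (w : Z → Z → A) (hs : W.sign c = W'.sign c')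
    (hi : ∀ s, κ (W.inn (c, s)) = κ' (W'.inn (c', s)))
    (ho : ∀ s, κ (W.out (c, s)) = κ' (W'.out (c', s))) :
    W.weight w κ c = W'.weight w κ' c' := by
  simp only [weight, hs, hi, ho]

/-- Renaming crossings and edges does not change the state sum. -/
theorem stateSum_congr {K' E' : Type} [Fintype K] [Fintype K'] {W : Wiring K E}
    {W' : Wiring K' E'} (w : Y → Y → A) (e : K ≃ K') (g : E ≃ E')
    (hs : ∀ c, W'.sign (e c) = W.sign c)
    (hi : ∀ c s, W'.inn (e c, s) = g (W.inn (c, s)))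
    (ho : ∀ c s, W'.out (e c, s) = g (W.out (c, s))) : W.stateSum w = W'.stateSum w := by
  have hcol : ∀ (κ' : E' → Y) c, W.IsColoredAt (κ' ∘ g) c ↔ W'.IsColoredAt κ' (e c) :=
    fun κ' c => isColoredAt_iff_of_edges (hs c).symm (fun s => by simp [hi])
      (fun s => by simp [ho])
  refine finsum_eq_of_biUnique (fun κ κ' => κ.1 = κ'.1 ∘ g) ?_ ?_ ?_ ?_ ?_
  · rintro ⟨κ, hκ⟩
    refine ⟨⟨κ ∘ g.symm, fun c' => ?_⟩, by ext; simp⟩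
    rw [← e.apply_symm_apply c', ← hcol]
    convert hκ _
    ext; simp
  · rintro ⟨κ', hκ'⟩
    exact ⟨⟨κ' ∘ g, fun c => (hcol κ' c).2 (hκ' _)⟩, rfl⟩
  · intro κ κ₁ κ₂ h₁ h₂
    exact Subtype.ext (g.surjective.injective_comp_right (h₁.symm.trans h₂))
  · intro κ₁ κ₂ κ' h₁ h₂
    exact Subtype.ext (h₁.trans h₂.symm)
  · intro κ κ' h
    congr 1
    refine Fintype.prod_equiv e _ _ fun c => weight_eq_of_edges w (hs c).symm ?_ ?_ <;>
      simp [h, hi, ho]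

/-! ### Erasing crossings -/

open Classical in
/-- The sum over the colorings of the crossings outside `S` by colors which do not change at
the crossings in `S`. -/
noncomputable def throughSum [Fintype K] (W : Wiring K E) (S : Set K) (w : Y → Y → A) :
    MonoidAlgebra ℤ A :=
  ∑ᶠ κ : {κ : E → Y // (∀ c ∉ S, W.IsColoredAt κ c) ∧
      ∀ c ∈ S, ∀ s, κ (W.inn (c, s)) = κ (W.out (c, s))},
    MonoidAlgebra.of ℤ A (∏ c, if c ∈ S then 1 else W.weight w κ.1 c)

/-- Colors which do not change at the crossings in `S` are colors of the wiring without `S`. -/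
theorem throughSum_eq_stateSum {K' E' : Type} [Fintype K] [Fintype K'] {W : Wiring K E}
    {W' : Wiring K' E'} (w : Y → Y → A) (S : Set K) (f : K' → K) (rep : E → E')
    (hf : Function.Injective f) (hS : Set.range f = Sᶜ) (hs : ∀ c, W.sign (f c) = W'.sign c)
    (hrep : Function.Surjective rep)
    (hi : ∀ c s, rep (W.inn (f c, s)) = W'.inn (c, s))
    (ho : ∀ c s, rep (W.out (f c, s)) = W'.out (c, s))
    (hio : ∀ c ∈ S, ∀ s, rep (W.inn (c, s)) = rep (W.out (c, s)))
    (hgen : ∀ e e', rep e = rep e' →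
      Relation.EqvGen (fun e e' => ∃ v, v.1 ∈ S ∧ e = W.inn v ∧ e' = W.out v) e e') :
    W.throughSum S w = W'.stateSum w := by
  have hcol : ∀ (κ' : E' → Y) c, W.IsColoredAt (κ' ∘ rep) (f c) ↔ W'.IsColoredAt κ' c :=
    fun κ' c => isColoredAt_iff_of_edges (hs c) (fun s => by simp [hi])
      (fun s => by simp [ho])
  have hfS : ∀ c, f c ∉ S := fun c => by
    have : f c ∈ Set.range f := ⟨c, rfl⟩
    rwa [hS] at this
  have hex : ∀ c ∉ S, ∃ c', f c' = c := fun c hc => by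
    have : c ∈ Sᶜ := hc
    rwa [← hS] at this
  refine finsum_eq_of_biUnique (fun κ κ' => κ.1 = κ'.1 ∘ rep) ?_ ?_ ?_ ?_ ?_
  · rintro ⟨κ, hκ, hκS⟩
    -- A color that does not change at `S` is constant on the classes generated by these passages,
    -- which by `hgen` contain the fibers of `rep`; hence it factors through `rep`.
    have hle : ∀ e e', Relation.EqvGen
        (fun e e' => ∃ v, v.1 ∈ S ∧ e = W.inn v ∧ e' = W.out v) e e' → κ e = κ e' := by
      intro e e' h
      induction h with
      | rel e e' h =>
        obtain ⟨v, hv, rfl, rfl⟩ := h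
        exact hκS _ hv _
      | refl => rfl
      | symm _ _ _ ih => exact ih.symm
      | trans _ _ _ _ _ ih₁ ih₂ => exact ih₁.trans ih₂
    have hfac : ∀ e e', rep e = rep e' → κ e = κ e' := fun e e' h => hle e e' (hgen e e' h)
    obtain ⟨κ', rfl⟩ : ∃ κ' : E' → Y, κ = κ' ∘ rep :=
      ⟨fun e' => κ (hrep e').choose, funext fun e => hfac _ _ (hrep (rep e)).choose_spec.symm⟩
    exact ⟨⟨κ', fun c => (hcol κ' c).1 (hκ _ (hfS c))⟩, rfl⟩
  · rintro ⟨κ', hκ'⟩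
    refine ⟨⟨κ' ∘ rep, fun c hc => ?_, fun c hc s => congrArg κ' (hio c hc s)⟩, rfl⟩
    obtain ⟨c, rfl⟩ := hex c hc
    exact (hcol κ' c).2 (hκ' c)
  · intro κ κ₁ κ₂ h₁ h₂
    exact Subtype.ext (hrep.injective_comp_right (h₁.symm.trans h₂))
  · intro κ₁ κ₂ κ' h₁ h₂
    exact Subtype.ext (h₁.trans h₂.symm)
  · intro κ κ' h
    congr 1
    -- Crossings outside the range of `f` lie in `S` and contribute the factor `1`.
    refine (Fintype.prod_of_injective f hf _ _ (fun c hc => ?_) fun c => ?_).symm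
    · rw [hS, Set.notMem_compl_iff] at hc
      rw [if_pos hc]
    · rw [if_neg (hfS c)]
      refine (weight_eq_of_edges w (hs c) ?_ ?_).symm <;> simp [h, hi, ho]

/-- Removing a kink. -/
theorem stateSum_eq_throughSum_singleton [Fintype K] {W : Wiring K E} {w : Y → Y → A}
    (hw : IsQuandleCocycle w) (c : K)
    (hc : W.out (c, Strand.over) = W.inn (c, Strand.under) ∨
      W.out (c, Strand.under) = W.inn (c, Strand.over)) :
    W.stateSum w = W.throughSum {c} w := by
  -- The under strand has the color of the over strand on one side of the kink, so it keeps that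
  -- color.
  have hiff : ∀ κ : E → Y, W.IsColoredAt κ c ↔ ∀ s, κ (W.inn (c, s)) = κ (W.out (c, s)) := by
    intro κ
    rw [IsColoredAt]
    constructor
    · rintro ⟨ho, hu⟩ s
      rcases hc with hc | hc
      · rw [hc, passesUnder_self_left] at hu
        cases s
        · exact ho.symm
        · exact hu.symm
      · rw [ho, ← hc, passesUnder_self_right] at hu
        cases s
        · exact ho.symm
        · exact hu
    · intro h
      refine ⟨(h _).symm, ?_⟩
      rcases hc with hc | hc
      · rw [hc, passesUnder_self_left, ← h]
      · rw [← h Strand.over, ← hc, passesUnder_self_right, h]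
  refine finsum_eq_of_biUnique (fun κ κ' => κ.1 = κ'.1) ?_ ?_ ?_ ?_ ?_
  · rintro ⟨κ, hκ⟩
    refine ⟨⟨κ, fun c _ => hκ c, fun d hd => ?_⟩, rfl⟩
    obtain rfl := Set.mem_singleton_iff.1 hd
    exact (hiff κ).1 (hκ d)
  · rintro ⟨κ, hκ, hκc⟩
    refine ⟨⟨κ, fun d => ?_⟩, rfl⟩
    by_cases hd : d = c
    · subst hd
      exact (hiff κ).2 (hκc d rfl)
    · exact hκ d hd
  · intro κ κ₁ κ₂ h₁ h₂
    exact Subtype.ext (h₁.symm.trans h₂)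
  · intro κ₁ κ₂ κ' h₁ h₂
    exact Subtype.ext (h₁.trans h₂.symm)
  · rintro ⟨κ, hκ⟩ ⟨κ', hκ'⟩ h
    obtain rfl : κ = κ' := h
    congr 1
    refine Finset.prod_congr rfl fun d _ => ?_
    split_ifs with hd
    · obtain rfl := Set.mem_singleton_iff.1 hd
      have h := (hiff κ).1 (hκ d)
      have hsrc : ∀ x : Y, underSource (W.sign d) x x = x := fun x => by simp [underSource]
      change w (underSource _ (κ _) (κ _)) (κ _) ^ _ = 1
      -- All edges at the kink have one color, so the weight is a power of `w x x`.
      rw [h Strand.under, hsrc]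
      rcases hc with hc | hc
      · rw [hc, h, hw.diag, one_zpow]
      · rw [hc, h, hw.diag, one_zpow]
    · rfl

/-- Removing a bigon whose middle under edge leads from the crossing `c` to `d`. -/
theorem stateSum_eq_throughSum_pair [Fintype K] {W : Wiring K E} {w : Y → Y → A}
    (hin : Function.Injective W.inn) (hout : Function.Injective W.out)
    {c d : K} (hcd : c ≠ d) (hs : W.sign d = -W.sign c)
    (hu : W.out (c, Strand.under) = W.inn (d, Strand.under))
    (ho : W.out (c, Strand.over) = W.inn (d, Strand.over) ∨
      W.out (d, Strand.over) = W.inn (c, Strand.over)) :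
    W.stateSum w = W.throughSum {c, d} w := by
  classical
  set m := W.out (c, Strand.under) with hm
  -- The middle edge `m` is met by no further passage, so its color can be changed without affecting
  -- any other crossing.
  have hmo : ∀ v, v ≠ (c, Strand.under) → W.out v ≠ m := fun v hv h => hv (hout h)
  have hmi : ∀ v, v ≠ (d, Strand.under) → W.inn v ≠ m := fun v hv h => hv (hin (h.trans hu))
  have hne : ∀ {x y : K}, x ≠ y → ∀ s s' : Strand, (x, s) ≠ (y, s') := fun h s s' h' =>
    h (congrArg Prod.fst h')
  have hso : ∀ x y : K, (x, Strand.over) ≠ (y, Strand.under) := fun x y h => by simp at h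
  have hic : W.inn (c, Strand.under) ≠ m := hmi _ (hne hcd _ _)
  have hod : W.out (d, Strand.under) ≠ m := hmo _ (hne hcd.symm _ _)
  -- the colors of the over strand
  have hover : ∀ κ : E → Y, (∀ x, x = c ∨ x = d →
      κ (W.out (x, Strand.over)) = κ (W.inn (x, Strand.over))) →
      κ (W.out (d, Strand.over)) = κ (W.out (c, Strand.over)) := by
    intro κ h
    rcases ho with ho | ho
    · rw [h d (Or.inr rfl), ← ho]
    · rw [h c (Or.inl rfl), ← ho]
  have hcolc : ∀ κ : E → Y, (∀ x, W.IsColoredAt κ x) →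
      κ (W.out (d, Strand.over)) = κ (W.out (c, Strand.over)) ∧
      κ (W.inn (c, Strand.under)) = κ (W.out (d, Strand.under)) := by
    intro κ hκ
    have h := hover κ fun x _ => (hκ x).1
    refine ⟨h, ?_⟩
    have h₁ := (hκ c).2
    have h₂ := (hκ d).2
    -- With opposite signs, both outer under colors result from the color of `m` by passing back
    -- under the same over color.
    rw [hs, passesUnder_neg, h, ← hu] at h₂
    rw [← passesUnder_neg] at h₁ h₂
    exact h₁.unique h₂
  have hother : ∀ {κ κ' : E → Y}, (∀ e, e ≠ m → κ e = κ' e) → ∀ x ∉ ({c, d} : Set K),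
      (∀ s, κ (W.inn (x, s)) = κ' (W.inn (x, s))) ∧
        ∀ s, κ (W.out (x, s)) = κ' (W.out (x, s)) := by
    intro κ κ' h x hx
    simp only [Set.mem_insert_iff, Set.mem_singleton_iff, not_or] at hx
    exact ⟨fun s => h _ (hmi _ (hne hx.2 _ _)), fun s => h _ (hmo _ (hne hx.1 _ _))⟩
  -- The color of `m` is determined on both sides: by the coloring condition at `c` for a coloring
  -- of `W`, by the outer under edges for a coloring that ignores the bigon.
  refine finsum_eq_of_biUnique (fun κ κ' => ∀ e, e ≠ m → κ.1 e = κ'.1 e) ?_ ?_ ?_ ?_ ?_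
  · rintro ⟨κ, hκ⟩
    have hup : ∀ e, e ≠ m → κ e = Function.update κ m (κ (W.inn (c, Strand.under))) e :=
      fun e he => (Function.update_of_ne he _ _).symm
    refine ⟨⟨Function.update κ m (κ (W.inn (c, Strand.under))), fun x hx => ?_, ?_⟩, hup⟩
    · exact (isColoredAt_iff_of_edges rfl (hother hup x hx).1 (hother hup x hx).2).1 (hκ x)
    · rintro x hx (_ | _)
      · rw [← hup _ (hmi _ (hso _ _)), ← hup _ (hmo _ (hso _ _)), (hκ x).1]
      · rcases hx with rfl | rfl
        · rw [← hup _ hic, ← hm, Function.update_self]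
        · rw [← hup _ hod, ← hu, Function.update_self, (hcolc κ hκ).2]
  · rintro ⟨κ, hκ, hκS⟩
    obtain ⟨z, hz⟩ := PassesUnder.exists (W.sign c) (κ (W.inn (c, Strand.under)))
      (κ (W.out (c, Strand.over)))
    have hup : ∀ e, e ≠ m → Function.update κ m z e = κ e :=
      fun e he => Function.update_of_ne he _ _
    refine ⟨⟨Function.update κ m z, fun x => ?_⟩, hup⟩
    by_cases hx : x ∈ ({c, d} : Set K)
    · refine ⟨?_, ?_⟩
      · rw [hup _ (hmi _ (hso _ _)), hup _ (hmo _ (hso _ _)), hκS x hx]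
      · rw [hup _ (hmo _ (hso _ _))]
        rcases hx with rfl | rfl
        · rw [hup _ hic, ← hm, Function.update_self]
          exact hz
        · rw [hup _ hod, ← hu, Function.update_self, hs, passesUnder_neg,
            hover κ fun y hy => (hκS y hy _).symm, ← hκS _ (Or.inr rfl), ← hu, hm,
            ← hκS _ (Or.inl rfl)]
          exact hz
    · exact (isColoredAt_iff_of_edges rfl (hother hup x hx).1 (hother hup x hx).2).2 (hκ x hx)
  · intro κ κ₁ κ₂ h₁ h₂
    have h : ∀ e, e ≠ m → κ₁.1 e = κ₂.1 e := fun e he => (h₁ e he).symm.trans (h₂ e he)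
    refine Subtype.ext (funext fun e => ?_)
    by_cases he : e = m
    · rw [he, hm, ← κ₁.2.2 c (Or.inl rfl), ← κ₂.2.2 c (Or.inl rfl), h _ hic]
    · exact h e he
  · intro κ₁ κ₂ κ h₁ h₂
    have h : ∀ e, e ≠ m → κ₁.1 e = κ₂.1 e := fun e he => (h₁ e he).trans (h₂ e he).symm
    refine Subtype.ext (funext fun e => ?_)
    by_cases he : e = m
    · have h₁ := (κ₁.2 c).2
      have h₂ := (κ₂.2 c).2
      rw [h _ hic, h _ (hmo _ (hso _ _))] at h₁
      rw [he]
      exact h₁.unique h₂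
    · exact h e he
  · rintro ⟨κ, hκ⟩ κ' h
    congr 1
    -- Both crossings have the same over color and the same source color, with opposite exponents.
    have hmul : W.weight w κ c * W.weight w κ d = 1 := by
      rw [weight, weight, hs, underSource_neg, (hcolc κ hκ).1, ← hu, (hcolc κ hκ).2,
        ← zpow_add]
      simp
    refine (Finset.prod_mul_prod_compl {c, d} _).symm.trans
      (Eq.trans ?_ (Finset.prod_mul_prod_compl {c, d} _))
    rw [Finset.prod_pair hcd, hmul, Finset.prod_pair hcd, if_pos (Set.mem_insert c {d}),
      if_pos (Set.mem_insert_of_mem c rfl : d ∈ ({c, d} : Set K)),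
      one_mul, one_mul, one_mul]
    refine Finset.prod_congr rfl fun x hx => ?_
    have hx' : x ∉ ({c, d} : Set K) := by simpa using hx
    rw [if_neg hx']
    exact weight_eq_of_edges w rfl (hother h x hx').1 (hother h x hx').2

end Wiring

/-! ## The wiring of a Gauss diagram -/

namespace GaussDiagram

/-- The edges of a diagram are its semi-arcs and its loops without crossings. -/
abbrev Edge (D : GaussDiagram) : Type := D.Passage ⊕ Fin D.loops

/-- The wiring of a diagram. -/
def wiring (D : GaussDiagram) : Wiring D.Crossing D.Edge where
  sign := D.sign
  inn v := Sum.inl (D.next.symm v)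
  out v := Sum.inl v

theorem wiring_inn_injective (D : GaussDiagram) : Function.Injective D.wiring.inn :=
  Sum.inl_injective.comp D.next.symm.injective

theorem wiring_out_injective (D : GaussDiagram) : Function.Injective D.wiring.out :=
  Sum.inl_injective

variable {D D' : GaussDiagram}

/-- The cycles of the diagram `D` that pass only through crossings in `S`. -/
abbrev ErasedCycle (D : GaussDiagram) (S : Set D.Crossing) : Type :=
  {q : D.Cycle // ∀ v : D.Passage, Quotient.mk _ v = q → v.1 ∈ S}

theorem cycle_mk_symm_pow (v : D.Passage) (n : ℕ) :
    (Quotient.mk _ ((D.next.symm ^ n) v) : D.Cycle) = Quotient.mk _ v := by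
  refine Quotient.sound ⟨n, ?_⟩
  have : D.next.symm = D.next⁻¹ := rfl
  rw [this, inv_pow, zpow_natCast]
  exact Equiv.apply_symm_apply (D.next ^ n) v

theorem exists_symm_pow_of_cycle_mk_eq {v v' : D.Passage}
    (h : (Quotient.mk _ v : D.Cycle) = Quotient.mk _ v') : ∃ n : ℕ, (D.next.symm ^ n) v = v' := by
  classical
  have h : D.next.SameCycle v v' := Quotient.exact h
  have : Finite D.Passage := inferInstance
  obtain ⟨n, hn⟩ := (Equiv.Perm.sameCycle_inv.2 h).exists_nat_pow_eq
  exact ⟨n, hn⟩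

open Classical in
/-- The edge of the diagram with the crossings in `S` erased that contains a given edge. It is
found by going back along the link to the last passage through a crossing outside `S`. -/
noncomputable def containingEdge {S : Set D.Crossing}
    (pre : ∀ v : D.Passage, v.1 ∉ S → D'.Passage)
    (σ : D.ErasedCycle S ⊕ Fin D.loops ≃ Fin D'.loops) :
    D.Edge → D'.Edge
  | Sum.inl v =>
    if h : ∃ n : ℕ, ((D.next.symm ^ n) v).1 ∉ S then Sum.inl (pre _ (Nat.find_spec h))
    else Sum.inr (σ (Sum.inl ⟨Quotient.mk _ v, fun v' hv' => by
      obtain ⟨n, rfl⟩ := exists_symm_pow_of_cycle_mk_eq hv'.symm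
      by_contra hn
      exact h ⟨n, hn⟩⟩))
  | Sum.inr i => Sum.inr (σ (Sum.inr i))

section

variable {S : Set D.Crossing} {pre : ∀ v : D.Passage, v.1 ∉ S → D'.Passage}
  {σ : D.ErasedCycle S ⊕ Fin D.loops ≃ Fin D'.loops}

theorem containingEdge_of_notMem {v : D.Passage} (hv : v.1 ∉ S) :
    containingEdge pre σ (Sum.inl v) = Sum.inl (pre v hv) := by
  classical
  have h : ∃ n : ℕ, ((D.next.symm ^ n) v).1 ∉ S := ⟨0, hv⟩
  have h0 : Nat.find h = 0 := (Nat.find_eq_zero h).2 hv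
  rw [containingEdge, dif_pos h]
  congr 2
  rw [h0]
  rfl

/-- Going back from `v` starts with a passage in `S`, so the search from the preceding passage ends
at the same place one step sooner. If it never ends, both passages lie on the same erased cycle. -/
theorem containingEdge_of_mem {v : D.Passage} (hv : v.1 ∈ S) :
    containingEdge pre σ (Sum.inl (D.next.symm v)) = containingEdge pre σ (Sum.inl v) := by
  classical
  have hsucc : ∀ n : ℕ, (D.next.symm ^ n) (D.next.symm v) = (D.next.symm ^ (n + 1)) v :=
    fun n => by rw [pow_succ]; rfl
  by_cases h : ∃ n : ℕ, ((D.next.symm ^ n) v).1 ∉ S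
  · have h' : ∃ n : ℕ, ((D.next.symm ^ n) (D.next.symm v)).1 ∉ S := by
      obtain ⟨n, hn⟩ := h
      cases n with
      | zero => exact absurd hv hn
      | succ n => exact ⟨n, by rwa [hsucc]⟩
    have hfind : Nat.find h = Nat.find h' + 1 :=
      Nat.find_comp_succ h (by simpa only [hsucc] using h') (fun hn => hn hv) |>.trans (by
        simp only [hsucc])
    rw [containingEdge, containingEdge, dif_pos h, dif_pos h']
    congr 2
    rw [hfind, hsucc]
  · have h' : ¬ ∃ n : ℕ, ((D.next.symm ^ n) (D.next.symm v)).1 ∉ S := fun ⟨n, hn⟩ =>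
      h ⟨n + 1, by rwa [← hsucc]⟩
    rw [containingEdge, containingEdge, dif_neg h, dif_neg h']
    congr 4
    exact cycle_mk_symm_pow v 1

theorem eqvGen_symm_pow {v : D.Passage} (n : ℕ) (hv : ∀ k < n, ((D.next.symm ^ k) v).1 ∈ S) :
    Relation.EqvGen (fun e e' => ∃ u : D.Passage, u.1 ∈ S ∧ e = D.wiring.inn u ∧
      e' = D.wiring.out u) (Sum.inl ((D.next.symm ^ n) v)) (Sum.inl v) := by
  induction n with
  | zero => exact .refl _
  | succ n ih =>
    refine .trans _ (Sum.inl ((D.next.symm ^ n) v)) _ (.rel _ _ ?_)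
      (ih fun k hk => hv k (hk.trans n.lt_succ_self))
    exact ⟨_, hv n n.lt_succ_self, by rw [pow_succ']; rfl, rfl⟩

/-- Every edge is connected through crossings in `S` to a standard edge. -/
theorem eqvGen_of_containingEdge_eq
    (hpre : ∀ v v' hv hv', pre v hv = pre v' hv' → v = v') {e e' : D.Edge}
    (h : containingEdge pre σ e = containingEdge pre σ e') :
    Relation.EqvGen (fun e e' => ∃ u : D.Passage, u.1 ∈ S ∧ e = D.wiring.inn u ∧
      e' = D.wiring.out u) e e' := by
  classical
  rcases e with v | i <;> rcases e' with v' | i' <;> simp only [containingEdge] at h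
  · split_ifs at h with h₁ h₂ h₂
    -- Both searches end at the same passage, to which both edges are joined.
    · have hv := hpre _ _ _ _ (Sum.inl_injective h)
      have e₁ := eqvGen_symm_pow (v := v) (Nat.find h₁) fun k hk =>
        not_not.1 (Nat.find_min h₁ hk)
      have e₂ := eqvGen_symm_pow (v := v') (Nat.find h₂) fun k hk =>
        not_not.1 (Nat.find_min h₂ hk)
      rw [hv] at e₁
      exact e₁.symm.trans _ _ _ e₂
    -- Both edges lie on one erased cycle, and every passage between them belongs to `S`.
    · have hq := congrArg Subtype.val (Sum.inl_injective (σ.injective (Sum.inr_injective h)))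
      obtain ⟨n, rfl⟩ := exists_symm_pow_of_cycle_mk_eq hq
      push Not at h₁
      exact (eqvGen_symm_pow n fun k _ => h₁ k).symm
  · split_ifs at h with h₁
    cases σ.injective (Sum.inr_injective h)
  · split_ifs at h with h₁
    cases σ.injective (Sum.inr_injective h)
  · cases σ.injective (Sum.inr_injective h)
    exact .refl _

theorem containingEdge_surjective (hpre : ∀ v', ∃ v hv, pre v hv = v') :
    Function.Surjective (containingEdge pre σ) := by
  classical
  rintro (v' | i)
  · obtain ⟨v, hv, rfl⟩ := hpre v'
    exact ⟨_, containingEdge_of_notMem hv⟩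
  · obtain ⟨⟨q, hq⟩ | i, rfl⟩ := σ.surjective i
    · induction q using Quotient.inductionOn with
      | h v =>
        refine ⟨Sum.inl v, ?_⟩
        have h : ¬ ∃ n : ℕ, ((D.next.symm ^ n) v).1 ∉ S := fun ⟨n, hn⟩ =>
          hn (hq _ (cycle_mk_symm_pow v n))
        rw [containingEdge, dif_neg h]
    · exact ⟨Sum.inr i, rfl⟩

end

/-- Erasing crossings at which colors do not change. -/
theorem IsErasure.throughSum_eq {Y A : Type*} [Quandle Y] [CommGroup A] {S : Set D.Crossing}
    {f : D'.Crossing → D.Crossing} (h : D.IsErasure D' S f) (w : Y → Y → A) :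
    D.wiring.throughSum S w = D'.wiring.stateSum w := by
  classical
  have hfS : ∀ c, f c ∉ S := fun c => by
    have : f c ∈ Set.range f := ⟨c, rfl⟩
    rwa [h.range_eq] at this
  have hex : ∀ v : D.Passage, v.1 ∉ S → ∃ v' : D'.Passage, (f v'.1, v'.2) = v := fun v hv => by
    have : v.1 ∈ Sᶜ := hv
    rw [← h.range_eq] at this
    obtain ⟨c, hc⟩ := this
    exact ⟨(c, v.2), by rw [hc]⟩
  choose pre hpre using hex
  have hinj : ∀ v v' : D'.Passage, (f v.1, v.2) = (f v'.1, v'.2) → v = v' := fun v v' hv =>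
    Prod.ext (h.injective (congrArg Prod.fst hv)) (congrArg Prod.snd hv :)
  have hpref : ∀ v : D'.Passage, pre (f v.1, v.2) (hfS _) = v := fun v => hinj _ _ (hpre _ _)
  have : Finite D.Cycle := Quotient.finite _
  -- The definition of erasure prescribes only the number of loops. Any bijection will do, since
  -- loops carry no crossings and their colors are unconstrained.
  obtain ⟨σ⟩ : Nonempty (D.ErasedCycle S ⊕ Fin D.loops ≃ Fin D'.loops) := by
    rw [← Finite.card_eq, Nat.card_sum, Nat.card_fin, Nat.card_fin, h.loops_eq, add_comm]
  have hout : ∀ v : D'.Passage,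
      containingEdge pre σ (Sum.inl (f v.1, v.2)) = Sum.inl v := fun v => by
    rw [containingEdge_of_notMem (hfS _), hpref]
  refine Wiring.throughSum_eq_stateSum w S f (containingEdge pre σ) h.injective h.range_eq
    h.sign_eq (containingEdge_surjective fun v' => ⟨_, hfS _, hpref v'⟩) (fun c s => ?_)
    (fun c s => hout (c, s)) (fun c hc s => containingEdge_of_mem hc)
    fun e e' => eqvGen_of_containingEdge_eq fun v v' hv hv' hvv => by
      rw [← hpre v hv, hvv, hpre v' hv']
  -- For incoming edges, walk forward from the preceding surviving passage `u`: the `n` passages on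
  -- the way are erased, so the containing edge remains that of `u`.
  obtain ⟨n, hn, hk⟩ := h.next_eq (D'.next.symm (c, s))
  rw [Equiv.apply_symm_apply] at hn
  generalize hu : D'.next.symm (c, s) = u at hn hk
  have hsymm : D.next.symm (f c, s) = (D.next ^ n) (f u.1, u.2) := by
    rw [Equiv.symm_apply_eq, ← hn, pow_succ']
    rfl
  have hpow : ∀ k ≤ n, containingEdge pre σ (Sum.inl ((D.next ^ k) (f u.1, u.2))) =
      Sum.inl u := by
    intro k
    induction k with
    | zero => exact fun _ => hout u
    | succ k ih =>
      intro hkn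
      rw [← ih (by omega), ← containingEdge_of_mem (hk k hkn)]
      congr 2
      rw [Equiv.symm_apply_eq, pow_succ']
      rfl
  change containingEdge pre σ (Sum.inl (D.next.symm (f c, s))) = Sum.inl (D'.next.symm (c, s))
  rw [hsymm, hpow n le_rfl, hu]

/-! ### Invariance under the first and second moves -/

variable {Y A : Type*} [Quandle Y] [CommGroup A] {w : Y → Y → A}

theorem IsMove₁.stateSum_eq (hw : IsQuandleCocycle w) (h : D.IsMove₁ D') :
    D.wiring.stateSum w = D'.wiring.stateSum w := by
  obtain ⟨c, hc, f, hf⟩ := h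
  rw [← hf.throughSum_eq, Wiring.stateSum_eq_throughSum_singleton hw c]
  refine hc.imp (fun hc => congrArg Sum.inl ?_) fun hc => congrArg Sum.inl ?_ <;>
    rw [← hc, Equiv.symm_apply_apply]

theorem IsMove₂.stateSum_eq (h : D.IsMove₂ D') :
    D.wiring.stateSum w = D'.wiring.stateSum w := by
  obtain ⟨c, d, hcd, hs, ho, hu, f, hf⟩ := h
  have hnext : ∀ {v v' : D.Passage}, D.next v = v' → D.wiring.out v = D.wiring.inn v' :=
    fun h => congrArg Sum.inl (by rw [← h, Equiv.symm_apply_apply])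
  rw [← hf.throughSum_eq]
  rcases hu with hu | hu
  · exact Wiring.stateSum_eq_throughSum_pair D.wiring_inn_injective D.wiring_out_injective hcd hs
      (hnext hu) (Or.inl (hnext ho))
  -- For antiparallel strands the roles of `c` and `d` are exchanged, so that the middle under edge
  -- again leads from the first crossing to the second.
  · rw [Set.pair_comm]
    exact Wiring.stateSum_eq_throughSum_pair D.wiring_inn_injective D.wiring_out_injective
      hcd.symm (neg_eq_iff_eq_neg.2 hs).symm (hnext hu) (Or.inr (hnext ho))

end GaussDiagram

/-! ## Moving a strand across a crossing -/

namespace Wiring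

variable {K E : Type} {Y A : Type*} [Quandle Y] [CommGroup A]

/-- The two edges of the passage `v`, in the order given by the direction `ε`. -/
def ends (W : Wiring K E) (ε : ℤˣ) (v : K × Strand) : E × E :=
  if ε = 1 then (W.inn v, W.out v) else (W.out v, W.inn v)

theorem ends_neg (W : Wiring K E) (ε : ℤˣ) (v : K × Strand) :
    W.ends (-ε) v = (W.ends ε v).swap := by
  obtain rfl | rfl := Int.units_eq_one_or ε <;> simp [ends]

theorem inn_out_of_ends {W : Wiring K E} {ε : ℤˣ} {v : K × Strand} {e e' : E}
    (h : W.ends ε v = (e, e')) :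
    ε = 1 ∧ W.inn v = e ∧ W.out v = e' ∨ ε = -1 ∧ W.out v = e ∧ W.inn v = e' := by
  obtain rfl | rfl := Int.units_eq_one_or ε <;> simpa [ends] using h

/-- Reversing the under strand exchanges its two colors, which amounts to changing the sign. The
direction of the over strand is irrelevant because its two colors agree. -/
theorem isColoredAt_iff_of_ends {W : Wiring K E} {c : K} {δ ε : ℤˣ} {o o' u u' : E}
    (ho : W.ends δ (c, Strand.over) = (o, o')) (hu : W.ends ε (c, Strand.under) = (u, u'))
    (κ : E → Y) :
    W.IsColoredAt κ c ↔ κ o = κ o' ∧ PassesUnder (W.sign c * ε) (κ u) (κ u') (κ o) := by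
  obtain ⟨rfl, rfl, rfl⟩ | ⟨rfl, rfl, rfl⟩ := inn_out_of_ends ho <;>
    obtain ⟨rfl, rfl, rfl⟩ | ⟨rfl, rfl, rfl⟩ := inn_out_of_ends hu <;>
    simp only [IsColoredAt, mul_one, mul_neg, passesUnder_neg]
  · exact ⟨fun h => ⟨h.1.symm, h.1 ▸ h.2⟩, fun h => ⟨h.1.symm, h.1 ▸ h.2⟩⟩
  · exact ⟨fun h => ⟨h.1.symm, h.1 ▸ h.2⟩, fun h => ⟨h.1.symm, h.1 ▸ h.2⟩⟩

theorem weight_eq_of_ends {W : Wiring K E} {c : K} {δ ε : ℤˣ} {o o' u u' : E}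
    (ho : W.ends δ (c, Strand.over) = (o, o')) (hu : W.ends ε (c, Strand.under) = (u, u'))
    {κ : E → Y} (hκ : W.IsColoredAt κ c) (w : Y → Y → A) :
    W.weight w κ c =
      w (underSource (W.sign c * ε) (κ u) (κ u')) (κ o) ^ ((W.sign c : ℤˣ) : ℤ) := by
  have h := ((isColoredAt_iff_of_ends ho hu κ).1 hκ).1
  obtain ⟨rfl, rfl, rfl⟩ | ⟨rfl, rfl, rfl⟩ := inn_out_of_ends ho <;>
    obtain ⟨rfl, rfl, rfl⟩ | ⟨rfl, rfl, rfl⟩ := inn_out_of_ends hu <;>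
    simp only [weight, mul_one, mul_neg, underSource_neg, h]

/-- A strand in direction `ε` runs through the edges `e₀`, `e₁`, `e₂`, and it meets the passages
`P`, `Q` in this order in the wiring `W`, and in the opposite order in `W'`. -/
structure StrandExchange (W W' : Wiring K E) (ε : ℤˣ) (P Q : K × Strand) (e₀ e₁ e₂ : E) :
    Prop where
  fst : W.ends ε P = (e₀, e₁)
  snd : W.ends ε Q = (e₁, e₂)
  fst' : W'.ends ε Q = (e₀, e₁)
  snd' : W'.ends ε P = (e₁, e₂)

namespace StrandExchange

variable {W W' : Wiring K E} {ε δ : ℤˣ} {P Q P' Q' : K × Strand} {e₀ e₁ e₂ f₀ f₁ f₂ : E}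

/-- Reversing the strand as well restores the order `P`, `Q`, so the inverse exchange has the same
form. -/
theorem symm (h : StrandExchange W W' ε P Q e₀ e₁ e₂) :
    StrandExchange W' W (-ε) P Q e₂ e₁ e₀ where
  fst := by rw [ends_neg, h.snd']; rfl
  snd := by rw [ends_neg, h.fst']; rfl
  fst' := by rw [ends_neg, h.snd]; rfl
  snd' := by rw [ends_neg, h.fst]; rfl

/-- The middle edge leaves one of `P`, `Q` and enters the other, so injectivity leaves no room for
another passage. -/
theorem ne_middle (h : StrandExchange W W' ε P Q e₀ e₁ e₂) (hin : Function.Injective W.inn)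
    (hout : Function.Injective W.out) {v : K × Strand} (hP : v ≠ P) (hQ : v ≠ Q) :
    W.inn v ≠ e₁ ∧ W.out v ≠ e₁ := by
  obtain ⟨rfl, -, h₁⟩ | ⟨rfl, -, h₁⟩ := inn_out_of_ends h.fst <;>
    obtain ⟨hε, h₂, -⟩ | ⟨hε, h₂, -⟩ := inn_out_of_ends h.snd
  · exact ⟨fun h => hQ (hin (h.trans h₂.symm)), fun h => hP (hout (h.trans h₁.symm))⟩
  · simp at hε
  · simp at hε
  · exact ⟨fun h => hP (hin (h.trans h₁.symm)), fun h => hQ (hout (h.trans h₂.symm))⟩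

theorem outer_ne_middle (h : StrandExchange W W' ε P Q e₀ e₁ e₂) (hin : Function.Injective W.inn)
    (hout : Function.Injective W.out) (hPQ : P ≠ Q) : e₀ ≠ e₁ ∧ e₂ ≠ e₁ := by
  obtain ⟨rfl, h₀, h₁⟩ | ⟨rfl, h₀, h₁⟩ := inn_out_of_ends h.fst <;>
    obtain ⟨hε, h₂, h₃⟩ | ⟨hε, h₂, h₃⟩ := inn_out_of_ends h.snd
  · exact ⟨fun h => hPQ (hin (h₀.trans (h.trans h₂.symm))),
      fun h => hPQ.symm (hout (h₃.trans (h.trans h₁.symm)))⟩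
  · simp at hε
  · simp at hε
  · exact ⟨fun h => hPQ (hout (h₀.trans (h.trans h₂.symm))),
      fun h => hPQ.symm (hin (h₃.trans (h.trans h₁.symm)))⟩

theorem edges_ne_middle (h : StrandExchange W W' ε P Q e₀ e₁ e₂)
    (h' : StrandExchange W W' δ P' Q' f₀ f₁ f₂) (hin : Function.Injective W.inn)
    (hout : Function.Injective W.out) (hP : P ≠ P' ∧ P ≠ Q') (hQ : Q ≠ P' ∧ Q ≠ Q') :
    e₀ ≠ f₁ ∧ e₁ ≠ f₁ ∧ e₂ ≠ f₁ := by
  have h₁ := h'.ne_middle hin hout hP.1 hP.2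
  have h₂ := h'.ne_middle hin hout hQ.1 hQ.2
  obtain ⟨-, rfl, rfl⟩ | ⟨-, rfl, rfl⟩ := inn_out_of_ends h.fst <;>
    obtain ⟨-, -, rfl⟩ | ⟨-, -, rfl⟩ := inn_out_of_ends h.snd
  · exact ⟨h₁.1, h₁.2, h₂.2⟩
  · exact ⟨h₁.1, h₁.2, h₂.1⟩
  · exact ⟨h₁.2, h₁.1, h₂.2⟩
  · exact ⟨h₁.2, h₁.1, h₂.1⟩

end StrandExchange

/-- The wirings `W` and `W'` differ by a move of the third kind at the crossings `a`, `b`, `c`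
of top over middle, top over bottom and middle over bottom strand. -/
structure TriangleExchange (W W' : Wiring K E) (η : ℤˣ) (a b c : K)
    (t₀ t₁ t₂ m₀ m₁ m₂ b₀ b₁ b₂ : E) : Prop where
  ab : a ≠ b
  ac : a ≠ c
  bc : b ≠ c
  inn_injective : Function.Injective W.inn
  out_injective : Function.Injective W.out
  inn_injective' : Function.Injective W'.inn
  out_injective' : Function.Injective W'.out
  sign_eq : ∀ x, W'.sign x = W.sign x
  inn_eq : ∀ x, x ≠ a → x ≠ b → x ≠ c → ∀ s, W'.inn (x, s) = W.inn (x, s)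
  out_eq : ∀ x, x ≠ a → x ≠ b → x ≠ c → ∀ s, W'.out (x, s) = W.out (x, s)
  top : StrandExchange W W' (η * W.sign c) (a, Strand.over) (b, Strand.over) t₀ t₁ t₂
  middle : StrandExchange W W' (η * W.sign b) (a, Strand.under) (c, Strand.over) m₀ m₁ m₂
  bottom : StrandExchange W W' (η * W.sign a) (b, Strand.under) (c, Strand.under) b₀ b₁ b₂

namespace TriangleExchange

variable {W W' : Wiring K E} {η : ℤˣ} {a b c : K} {t₀ t₁ t₂ m₀ m₁ m₂ b₀ b₁ b₂ : E}

/-- The inverse of a triangle move is a triangle move with all strands reversed. Statements about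
`W` therefore transfer to `W'`. -/
theorem symm (h : TriangleExchange W W' η a b c t₀ t₁ t₂ m₀ m₁ m₂ b₀ b₁ b₂) :
    TriangleExchange W' W (-η) a b c t₂ t₁ t₀ m₂ m₁ m₀ b₂ b₁ b₀ where
  ab := h.ab
  ac := h.ac
  bc := h.bc
  inn_injective := h.inn_injective'
  out_injective := h.out_injective'
  inn_injective' := h.inn_injective
  out_injective' := h.out_injective
  sign_eq x := (h.sign_eq x).symm
  inn_eq x ha hb hc s := (h.inn_eq x ha hb hc s).symm
  out_eq x ha hb hc s := (h.out_eq x ha hb hc s).symm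
  top := by rw [h.sign_eq, neg_mul]; exact h.top.symm
  middle := by rw [h.sign_eq, neg_mul]; exact h.middle.symm
  bottom := by rw [h.sign_eq, neg_mul]; exact h.bottom.symm

/-- Here the sign condition on the triangle enters: sign times direction of the under strand is
`sign a * (η * sign b)` at `a` and `sign b * (η * sign a)` at `b`. These agree, so the middle and
bottom strands pass under the top strand in the same sense, as self-distributivity requires. -/
theorem isColoredAt_iff (h : TriangleExchange W W' η a b c t₀ t₁ t₂ m₀ m₁ m₂ b₀ b₁ b₂)
    (κ : E → Y) :
    (W.IsColoredAt κ a ∧ W.IsColoredAt κ b ∧ W.IsColoredAt κ c) ↔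
      κ t₀ = κ t₁ ∧ κ t₁ = κ t₂ ∧ κ m₁ = κ m₂ ∧
      PassesUnder (η * W.sign a * W.sign b) (κ m₀) (κ m₁) (κ t₁) ∧
      PassesUnder (η * W.sign a * W.sign b) (κ b₀) (κ b₁) (κ t₁) ∧
      PassesUnder (η * W.sign a * W.sign c) (κ b₁) (κ b₂) (κ m₁) := by
  rw [isColoredAt_iff_of_ends h.top.fst h.middle.fst,
    isColoredAt_iff_of_ends h.top.snd h.bottom.fst,
    isColoredAt_iff_of_ends h.middle.snd h.bottom.snd,
    show W.sign a * (η * W.sign b) = η * W.sign a * W.sign b by ac_rfl,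
    show W.sign b * (η * W.sign a) = η * W.sign a * W.sign b by ac_rfl,
    show W.sign c * (η * W.sign a) = η * W.sign a * W.sign c by ac_rfl]
  constructor
  · rintro ⟨⟨h₁, h₂⟩, ⟨h₃, h₄⟩, h₅, h₆⟩
    exact ⟨h₁, h₃, h₅, h₁ ▸ h₂, h₄, h₆⟩
  · rintro ⟨h₁, h₃, h₅, h₂, h₄, h₆⟩
    exact ⟨⟨h₁, h₁ ▸ h₂⟩, ⟨h₃, h₄⟩, h₅, h₆⟩

/-- This is the criterion for the inverse move; replacing `η` by `-η` reverses each passage under a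
strand. -/
theorem isColoredAt_iff' (h : TriangleExchange W W' η a b c t₀ t₁ t₂ m₀ m₁ m₂ b₀ b₁ b₂)
    (κ : E → Y) :
    (W'.IsColoredAt κ a ∧ W'.IsColoredAt κ b ∧ W'.IsColoredAt κ c) ↔
      κ t₀ = κ t₁ ∧ κ t₁ = κ t₂ ∧ κ m₀ = κ m₁ ∧
      PassesUnder (η * W.sign a * W.sign b) (κ m₁) (κ m₂) (κ t₁) ∧
      PassesUnder (η * W.sign a * W.sign b) (κ b₁) (κ b₂) (κ t₁) ∧
      PassesUnder (η * W.sign a * W.sign c) (κ b₀) (κ b₁) (κ m₁) := by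
  rw [h.symm.isColoredAt_iff, h.sign_eq, h.sign_eq, h.sign_eq, neg_mul, neg_mul, neg_mul,
    passesUnder_neg, passesUnder_neg, passesUnder_neg, eq_comm (a := κ t₂),
    eq_comm (a := κ t₁) (b := κ t₀), eq_comm (a := κ m₁)]
  tauto

/-- Recoloring `m₁` and `b₁` must not disturb the other edges of the triangle. The outer edges may
coincide with one another. -/
theorem edges_ne (h : TriangleExchange W W' η a b c t₀ t₁ t₂ m₀ m₁ m₂ b₀ b₁ b₂) :
    (t₀ ≠ m₁ ∧ t₁ ≠ m₁ ∧ t₂ ≠ m₁ ∧ m₀ ≠ m₁ ∧ m₂ ≠ m₁ ∧ b₀ ≠ m₁ ∧ b₁ ≠ m₁ ∧ b₂ ≠ m₁) ∧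
    (t₀ ≠ b₁ ∧ t₁ ≠ b₁ ∧ t₂ ≠ b₁ ∧ m₀ ≠ b₁ ∧ m₂ ≠ b₁ ∧ b₀ ≠ b₁ ∧ b₂ ≠ b₁) := by
  have hab := h.ab
  have hac := h.ac
  have hbc := h.bc
  have h₁ := h.top.edges_ne_middle h.middle h.inn_injective h.out_injective
    (by simp [hac]) (by simp [hbc])
  have h₂ := h.top.edges_ne_middle h.bottom h.inn_injective h.out_injective (by simp) (by simp)
  have h₃ := h.middle.edges_ne_middle h.bottom h.inn_injective h.out_injective
    (by simp [hab, hac]) (by simp)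
  have h₄ := h.bottom.edges_ne_middle h.middle h.inn_injective h.out_injective
    (by simp [hab.symm]) (by simp [hac.symm])
  have h₅ := h.middle.outer_ne_middle h.inn_injective h.out_injective (by simp)
  have h₆ := h.bottom.outer_ne_middle h.inn_injective h.out_injective (by simp [hbc])
  tauto

/-- At the other crossings, only the colors outside the triangle matter. -/
theorem edges_eq (h : TriangleExchange W W' η a b c t₀ t₁ t₂ m₀ m₁ m₂ b₀ b₁ b₂)
    {Z : Type*} {κ κ' : E → Z} (hκ : ∀ e, e ≠ m₁ → e ≠ b₁ → κ e = κ' e) {x : K}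
    (ha : x ≠ a) (hb : x ≠ b) (hc : x ≠ c) :
    (∀ s, κ (W.inn (x, s)) = κ' (W'.inn (x, s))) ∧
      ∀ s, κ (W.out (x, s)) = κ' (W'.out (x, s)) := by
  have hne : ∀ {y : K}, x ≠ y → ∀ s s' : Strand, (x, s) ≠ (y, s') := fun h s s' h' =>
    h (congrArg Prod.fst h')
  have h₁ := fun s => h.middle.ne_middle h.inn_injective h.out_injective (hne ha s _) (hne hc s _)
  have h₂ := fun s => h.bottom.ne_middle h.inn_injective h.out_injective (hne hb s _) (hne hc s _)
  refine ⟨fun s => ?_, fun s => ?_⟩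
  · rw [h.inn_eq x ha hb hc, hκ _ (h₁ s).1 (h₂ s).1]
  · rw [h.out_eq x ha hb hc, hκ _ (h₁ s).2 (h₂ s).2]

/-- Every coloring extends across the triangle move. -/
theorem exists_coloring (h : TriangleExchange W W' η a b c t₀ t₁ t₂ m₀ m₁ m₂ b₀ b₁ b₂)
    {κ : E → Y} (hκ : ∀ x, W.IsColoredAt κ x) :
    ∃ κ' : E → Y, (∀ x, W'.IsColoredAt κ' x) ∧ ∀ e, e ≠ m₁ → e ≠ b₁ → κ e = κ' e := by
  classical
  obtain ⟨ht, ht', hm, h₁, h₂, h₃⟩ := (h.isColoredAt_iff κ).1 ⟨hκ a, hκ b, hκ c⟩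
  -- In `W'` the crossing `c` comes first on the middle and bottom strands: `m₁` keeps the color of
  -- `m₀`, and `z` is what `b₀` becomes on passing under it.
  obtain ⟨z, hz⟩ := PassesUnder.exists (η * W.sign a * W.sign c) (κ b₀) (κ m₀)
  have hne := h.edges_ne
  have hoff : ∀ e, e ≠ m₁ → e ≠ b₁ →
      κ e = Function.update (Function.update κ m₁ (κ m₀)) b₁ z e := fun e h₁ h₂ => by
    rw [Function.update_of_ne h₂, Function.update_of_ne h₁]
  have hall := (h.isColoredAt_iff' (Function.update (Function.update κ m₁ (κ m₀)) b₁ z)).2 (by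
    rw [Function.update_self, Function.update_of_ne hne.1.2.2.2.2.2.2.1.symm, Function.update_self]
    rw [← hoff t₀ (by tauto) (by tauto), ← hoff t₁ (by tauto) (by tauto),
      ← hoff t₂ (by tauto) (by tauto), ← hoff m₀ (by tauto) (by tauto),
      ← hoff m₂ (by tauto) (by tauto), ← hoff b₀ (by tauto) (by tauto),
      ← hoff b₂ (by tauto) (by tauto)]
    exact ⟨ht, ht', rfl, hm ▸ h₁, h₁.exchange h₂ h₃ hz, hz⟩)
  refine ⟨_, fun x => ?_, hoff⟩
  by_cases ha : x = a
  · exact ha ▸ hall.1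
  by_cases hb : x = b
  · exact hb ▸ hall.2.1
  by_cases hc : x = c
  · exact hc ▸ hall.2.2
  have hx := h.edges_eq hoff ha hb hc
  exact (isColoredAt_iff_of_edges (h.sign_eq x).symm hx.1 hx.2).1 (hκ x)

/-- A coloring is determined by the colors outside the triangle. -/
theorem coloring_unique (h : TriangleExchange W W' η a b c t₀ t₁ t₂ m₀ m₁ m₂ b₀ b₁ b₂)
    {κ κ' : E → Y} (hκ : ∀ x, W.IsColoredAt κ x)
    (hκ' : ∀ x, W.IsColoredAt κ' x) (hoff : ∀ e, e ≠ m₁ → e ≠ b₁ → κ e = κ' e) : κ = κ' := by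
  obtain ⟨-, -, hm, h₁, h₂, -⟩ := (h.isColoredAt_iff κ).1 ⟨hκ a, hκ b, hκ c⟩
  obtain ⟨-, -, hm', h₁', h₂', -⟩ := (h.isColoredAt_iff κ').1 ⟨hκ' a, hκ' b, hκ' c⟩
  have hne := h.edges_ne
  rw [hoff b₀ (by tauto) (by tauto), hoff t₁ (by tauto) (by tauto)] at h₂
  funext e
  by_cases he : e = m₁
  · rw [he, hm, hm', hoff m₂ (by tauto) (by tauto)]
  by_cases he' : e = b₁
  · rw [he']
    exact h₂.unique h₂'
  exact hoff e he he'

/-- The weight at `a` is unchanged, the weights at `b` and `c` together are handled by the cocycle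
identity, and the remaining crossings do not meet the recolored edges. -/
theorem prod_weight_eq (h : TriangleExchange W W' η a b c t₀ t₁ t₂ m₀ m₁ m₂ b₀ b₁ b₂)
    [Fintype K] {w : Y → Y → A} (hw : IsQuandleCocycle w) {κ κ' : E → Y}
    (hκ : ∀ x, W.IsColoredAt κ x) (hκ' : ∀ x, W'.IsColoredAt κ' x)
    (hoff : ∀ e, e ≠ m₁ → e ≠ b₁ → κ e = κ' e) :
    ∏ x, W.weight w κ x = ∏ x, W'.weight w κ' x := by
  classical
  obtain ⟨ht, ht', hm, h₁, h₂, h₃⟩ := (h.isColoredAt_iff κ).1 ⟨hκ a, hκ b, hκ c⟩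
  obtain ⟨-, -, hm', -, -, h₃'⟩ := (h.isColoredAt_iff' κ').1 ⟨hκ' a, hκ' b, hκ' c⟩
  have hne := h.edges_ne
  rw [← hm', ← hoff b₀ (by tauto) (by tauto), ← hoff m₀ (by tauto) (by tauto)] at h₃'
  refine (Finset.prod_mul_prod_compl {a, b, c} _).symm.trans
    (Eq.trans ?_ (Finset.prod_mul_prod_compl {a, b, c} _))
  congr 1
  · have hs : W.sign b * W.sign c =
        (η * W.sign a * W.sign b) * (η * W.sign a * W.sign c) := by
      rw [mul_mul_mul_comm, Int.units_mul_self, one_mul]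
    have key := hw.exchange hs h₁ h₂ h₃ h₃'
    have hnot : a ∉ ({b, c} : Finset K) := by simp [h.ab, h.ac]
    rw [Finset.prod_insert hnot, Finset.prod_insert hnot, Finset.prod_pair h.bc,
      Finset.prod_pair h.bc,
      weight_eq_of_ends h.top.fst h.middle.fst (hκ a),
      weight_eq_of_ends h.top.snd h.bottom.fst (hκ b),
      weight_eq_of_ends h.middle.snd h.bottom.snd (hκ c),
      weight_eq_of_ends h.top.snd' h.middle.snd' (hκ' a),
      weight_eq_of_ends h.top.fst' h.bottom.snd' (hκ' b),
      weight_eq_of_ends h.middle.fst' h.bottom.fst' (hκ' c), h.sign_eq, h.sign_eq, h.sign_eq,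
      show W.sign a * (η * W.sign b) = η * W.sign a * W.sign b by ac_rfl,
      show W.sign b * (η * W.sign a) = η * W.sign a * W.sign b by ac_rfl,
      show W.sign c * (η * W.sign a) = η * W.sign a * W.sign c by ac_rfl,
      ← hm', ← hoff t₁ (by tauto) (by tauto), ← hoff t₀ (by tauto) (by tauto),
      ← hoff m₀ (by tauto) (by tauto), ← hoff m₂ (by tauto) (by tauto),
      ← hoff b₀ (by tauto) (by tauto), ← hoff b₂ (by tauto) (by tauto), ht, ← hm, key]
  · refine Finset.prod_congr rfl fun x hx => ?_
    simp only [Finset.mem_compl, Finset.mem_insert, Finset.mem_singleton, not_or] at hx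
    have hx := h.edges_eq hoff hx.1 hx.2.1 hx.2.2
    exact weight_eq_of_edges w (h.sign_eq x).symm hx.1 hx.2

theorem stateSum_eq (h : TriangleExchange W W' η a b c t₀ t₁ t₂ m₀ m₁ m₂ b₀ b₁ b₂)
    [Fintype K] {w : Y → Y → A} (hw : IsQuandleCocycle w) :
    W.stateSum w = W'.stateSum w := by
  refine finsum_eq_of_biUnique (fun κ κ' => ∀ e, e ≠ m₁ → e ≠ b₁ → κ.1 e = κ'.1 e)
    ?_ ?_ ?_ ?_ ?_
  · rintro ⟨κ, hκ⟩
    obtain ⟨κ', hκ', hoff⟩ := h.exists_coloring hκ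
    exact ⟨⟨κ', hκ'⟩, hoff⟩
  · rintro ⟨κ', hκ'⟩
    obtain ⟨κ, hκ, hoff⟩ := h.symm.exists_coloring hκ'
    exact ⟨⟨κ, hκ⟩, fun e he he' => (hoff e he he').symm⟩
  · intro κ κ₁ κ₂ h₁ h₂
    exact Subtype.ext (h.symm.coloring_unique κ₁.2 κ₂.2 fun e he he' =>
      (h₁ e he he').symm.trans (h₂ e he he'))
  · intro κ₁ κ₂ κ h₁ h₂
    exact Subtype.ext (h.coloring_unique κ₁.2 κ₂.2 fun e he he' =>
      (h₁ e he he').trans (h₂ e he he').symm)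
  · intro κ κ' hoff
    rw [h.prod_weight_eq hw κ.2 κ'.2 hoff]

end TriangleExchange

end Wiring

/-! ### Relabelings and the third move on Gauss diagrams -/

namespace GaussDiagram

variable {D D' : GaussDiagram} {Y A : Type*} [Quandle Y] [CommGroup A] {w : Y → Y → A}

/-- The wiring of a diagram after a permutation of its passages. -/
def permutedWiring (D : GaussDiagram) (τ : Equiv.Perm D.Passage) : Wiring D.Crossing D.Edge where
  sign := D.sign
  inn v := Sum.inl (D.next.symm (τ v))
  out v := Sum.inl (τ v)

/-- The permuted wiring keeps the edges of `D`, and `τ` followed by `e` renames them as edges of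
`D'`. As `τ` is an involution, the edge `τ (c, s)` leaving `(c, s)` in the permuted wiring is
renamed `(e c, s)`. -/
theorem permutedWiring_stateSum_eq (τ : Equiv.Perm D.Passage) (hτ : ∀ v, τ (τ v) = v)
    (e : D.Crossing ≃ D'.Crossing) (hs : ∀ x, D'.sign (e x) = D.sign x)
    (hnext : ∀ v, D'.next (e (τ v).1, (τ v).2) = (e (τ (D.next v)).1, (τ (D.next v)).2))
    (hl : D'.loops = D.loops) (w : Y → Y → A) :
    (D.permutedWiring τ).stateSum w = D'.wiring.stateSum w := by
  let g : D.Passage ≃ D'.Passage := τ.trans (e.prodCongr (Equiv.refl _))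
  have hg : ∀ v, D'.next (g v) = g (D.next v) := hnext
  have hgτ : ∀ c s, g (τ (c, s)) = (e c, s) := fun c s => by
    change (e (τ (τ (c, s))).1, (τ (τ (c, s))).2) = _
    rw [hτ]
  refine Wiring.stateSum_congr w e (g.sumCongr (finCongr hl.symm)) hs (fun c s => ?_) fun c s => ?_
  · change Sum.inl (D'.next.symm (e c, s)) = Sum.inl (g (D.next.symm (τ (c, s))))
    rw [Equiv.symm_apply_eq .. |>.2]
    rw [hg, Equiv.apply_symm_apply, hgτ]
  · exact congrArg Sum.inl (hgτ c s).symm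

theorem IsRelabeling.stateSum_eq (h : D.IsRelabeling D') (w : Y → Y → A) :
    D.wiring.stateSum w = D'.wiring.stateSum w := by
  obtain ⟨e, hs, hnext, hl⟩ := h
  exact permutedWiring_stateSum_eq (Equiv.refl _) (fun _ => rfl) e hs hnext hl w

theorem Adjacent.strandExchange {ε : ℤˣ} {P Q : D.Passage} (h : D.Adjacent ε P Q)
    {τ : Equiv.Perm D.Passage} (hP : τ P = Q) (hQ : τ Q = P) :
    ∃ e₀ e₁ e₂, Wiring.StrandExchange D.wiring (D.permutedWiring τ) ε P Q e₀ e₁ e₂ := by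
  obtain rfl | rfl := Int.units_eq_one_or ε
  · have h : D.next P = Q := by simpa [Adjacent] using h
    have h' : D.next.symm Q = P := by rw [← h, Equiv.symm_apply_apply]
    -- A semi-arc is labelled by the passage it leaves, so these are the edges before, between and
    -- after `P` and `Q`; below, for the opposite direction, they are listed in reverse.
    exact ⟨Sum.inl (D.next.symm P), Sum.inl P, Sum.inl Q,
      ⟨by simp [Wiring.ends, wiring], by simp [Wiring.ends, wiring, h'],
        by simp [Wiring.ends, permutedWiring, hQ],
        by simp [Wiring.ends, permutedWiring, hP, h']⟩⟩
  · have h : D.next Q = P := by simpa [Adjacent] using h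
    have h' : D.next.symm P = Q := by rw [← h, Equiv.symm_apply_apply]
    exact ⟨Sum.inl P, Sum.inl Q, Sum.inl (D.next.symm Q),
      ⟨by simp [Wiring.ends, wiring, h'], by simp [Wiring.ends, wiring],
        by simp [Wiring.ends, permutedWiring, hQ, h'],
        by simp [Wiring.ends, permutedWiring, hP]⟩⟩

theorem IsMove₃.stateSum_eq (hw : IsQuandleCocycle w) (h : D.IsMove₃ D') :
    D.wiring.stateSum w = D'.wiring.stateSum w := by
  classical
  obtain ⟨a, b, c, η, hab, hac, hbc, htop, hmid, hbot, e, hs, hnext, hl⟩ := h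
  have hba := hab.symm
  have hca := hac.symm
  have hcb := hbc.symm
  have hτ : ∀ v, D.triangleSwap a b c v =
      Equiv.swap (a, Strand.over) (b, Strand.over) (Equiv.swap (a, Strand.under) (c, Strand.over)
        (Equiv.swap (b, Strand.under) (c, Strand.under) v)) := fun v => by
    simp only [triangleSwap, Equiv.Perm.mul_apply]
  have h₁ : D.triangleSwap a b c (a, Strand.over) = (b, Strand.over) := by
    simp [Equiv.swap_apply_def, *]
  have h₂ : D.triangleSwap a b c (b, Strand.over) = (a, Strand.over) := by
    simp [Equiv.swap_apply_def, *]
  have h₃ : D.triangleSwap a b c (a, Strand.under) = (c, Strand.over) := by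
    simp [Equiv.swap_apply_def, *]
  have h₄ : D.triangleSwap a b c (c, Strand.over) = (a, Strand.under) := by
    simp [Equiv.swap_apply_def, *]
  have h₅ : D.triangleSwap a b c (b, Strand.under) = (c, Strand.under) := by
    simp [Equiv.swap_apply_def, *]
  have h₆ : D.triangleSwap a b c (c, Strand.under) = (b, Strand.under) := by
    simp [Equiv.swap_apply_def, *]
  have h₇ : ∀ x, x ≠ a → x ≠ b → x ≠ c → ∀ s, D.triangleSwap a b c (x, s) = (x, s) :=
    fun x ha hb hc s => by simp [hτ, Equiv.swap_apply_def, ha, hb, hc]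
  have hinv : ∀ v, D.triangleSwap a b c (D.triangleSwap a b c v) = v := by
    rintro ⟨x, s⟩
    by_cases ha : x = a
    · subst ha
      cases s
      · rw [h₁, h₂]
      · rw [h₃, h₄]
    by_cases hb : x = b
    · subst hb
      cases s
      · rw [h₂, h₁]
      · rw [h₅, h₆]
    by_cases hc : x = c
    · subst hc
      cases s
      · rw [h₄, h₃]
      · rw [h₆, h₅]
    rw [h₇ x ha hb hc, h₇ x ha hb hc]
  obtain ⟨t₀, t₁, t₂, ht⟩ := htop.strandExchange h₁ h₂
  obtain ⟨m₀, m₁, m₂, hm⟩ := hmid.strandExchange h₃ h₄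
  obtain ⟨b₀, b₁, b₂, hb⟩ := hbot.strandExchange h₅ h₆
  have hex : Wiring.TriangleExchange D.wiring (D.permutedWiring (D.triangleSwap a b c)) η a b c
      t₀ t₁ t₂ m₀ m₁ m₂ b₀ b₁ b₂ :=
    { ab := hab
      ac := hac
      bc := hbc
      inn_injective := D.wiring_inn_injective
      out_injective := D.wiring_out_injective
      inn_injective' := D.wiring_inn_injective.comp (Equiv.injective _)
      out_injective' := D.wiring_out_injective.comp (Equiv.injective _)
      sign_eq := fun _ => rfl
      inn_eq := fun x ha hb hc s =>
        congrArg (fun v => Sum.inl (D.next.symm v)) (h₇ x ha hb hc s)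
      out_eq := fun x ha hb hc s => congrArg Sum.inl (h₇ x ha hb hc s)
      top := ht
      middle := hm
      bottom := hb }
  rw [hex.stateSum_eq hw]
  exact permutedWiring_stateSum_eq _ hinv e hs (fun v => hnext v _ rfl) hl w

end GaussDiagram

/-! ## Path components of topological quandles -/

section PathComponent

variable {X : Type*} [TopologicalSpace X]

/-- Any three points of a path component are the vertices of a singular `2`-simplex. -/
theorem exists_triangle_of_joined {x y z : X} (hxy : Joined x y) (hyz : Joined y z) :
    ∃ s : SingularSimplex X 2, s.vertex 0 = x ∧ s.vertex 1 = y ∧ s.vertex 2 = z := by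
  let γ := hxy.somePath.trans hyz.somePath
  -- An affine function with values `0`, `1/2`, `1` at the vertices, the parameters at which the
  -- concatenated path is at `x`, `y`, `z`. The triangle is collapsed onto this path.
  let g : stdSimplex ℝ (Fin 3) → ℝ := fun p => p.1 1 / 2 + p.1 2
  have hg : Continuous g := by
    have h : ∀ i : Fin 3, Continuous fun p : stdSimplex ℝ (Fin 3) => p.1 i :=
      fun i => (continuous_apply i).comp continuous_subtype_val
    exact ((h 1).div_const 2).add (h 2)
  refine ⟨⟨fun p => γ.extend (g p), γ.continuous_extend.comp hg⟩, ?_, ?_, ?_⟩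
  · have : g (stdSimplex.vertex 0) = 0 := by simp [g, stdSimplex.vertex]
    change γ.extend (g _) = x
    rw [this, γ.extend_zero]
  · have : g (stdSimplex.vertex 1) = 1 / 2 := by simp [g, stdSimplex.vertex]
    change γ.extend (g _) = y
    rw [this, Path.extend_apply _ (by norm_num), Path.trans_apply]
    simp
  · have : g (stdSimplex.vertex 2) = 1 := by simp [g, stdSimplex.vertex]
    change γ.extend (g _) = z
    rw [this, γ.extend_one]

theorem SingularSimplex.vertex_reindex {m n : ℕ} (s : SingularSimplex X n)
    (f : Fin (m + 1) → Fin (n + 1)) (i : Fin (m + 1)) :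
    (s.reindex f).vertex i = s.vertex (f i) := by
  change s (stdSimplex.map f (stdSimplex.vertex i)) = s (stdSimplex.vertex (f i))
  rw [stdSimplex.map_vertex]

/-- The points of a path component. -/
abbrev PathComponentPoint (α : ZerothHomotopy X) : Type _ :=
  {x : X // (Quotient.mk _ x : ZerothHomotopy X) = α}

theorem PathComponentPoint.joined {α : ZerothHomotopy X} (x y : PathComponentPoint α) :
    Joined x.1 y.1 :=
  Quotient.exact (x.2.trans y.2.symm)

variable [Quandle X] [IsTopologicalQuandle X]

theorem Joined.qop_left {x y : X} (h : Joined x y) (z : X) : Joined (qop x z) (qop y z) :=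
  ⟨h.somePath.map (IsTopologicalQuandle.isHomeomorph_qop z).continuous⟩

theorem Joined.qop_self_left {x y : X} (h : Joined x y) : Joined (qop x y) y := by
  simpa using h.qop_left y

/-- The translation by `y` is a homeomorphism fixing `y`, so its inverse carries a path from `x ▷ y`
to `y` back to a path from `x` to `y`. This keeps the inverse operation inside the path component.
-/
theorem Joined.of_qop {x y : X} (h : Joined (qop x y) y) : Joined x y := by
  let e := (IsTopologicalQuandle.isHomeomorph_qop y).homeomorph
  have h' : Joined (e x) (e y) := by
    change Joined (qop x y) (qop y y)
    rwa [qop_self]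
  have h'' : Joined (e.symm (e x)) (e.symm (e y)) := ⟨h'.somePath.map e.symm.continuous⟩
  rwa [e.symm_apply_apply, e.symm_apply_apply] at h''

/-- Path components are subquandles. -/
instance (α : ZerothHomotopy X) : Quandle (PathComponentPoint α) where
  act y x := ⟨Shelf.act y.1 x.1, (Quotient.sound (x.joined y).qop_self_left).trans y.2⟩
  invAct y x := ⟨Rack.invAct y.1 x.1, (Quotient.sound (Joined.of_qop (by
    rw [qop, Rack.right_inv]
    exact x.joined y))).trans y.2⟩
  self_distrib := Subtype.ext Shelf.self_distrib
  left_inv y x := Subtype.ext (Rack.left_inv y.1 x.1)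
  right_inv y x := Subtype.ext (Rack.right_inv y.1 x.1)
  fix := Subtype.ext Quandle.fix

theorem coe_qop {α : ZerothHomotopy X} (x y : PathComponentPoint α) :
    (qop x y).1 = qop x.1 y.1 := rfl

/-! ### Cocycles -/

variable {A : Type*} [CommGroup A]

/-- The values of a cocycle on the edges of a path component. -/
noncomputable def edgeWeight (φ : QCocycle X A 1) (α : ZerothHomotopy X)
    (x y : PathComponentPoint α) : A :=
  Additive.toMul (φ.1 (edgeClass (x.joined y)))

theorem edgeWeight_eq (φ : QCocycle X A 1) {α : ZerothHomotopy X} {x y : PathComponentPoint α}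
    (s : SingularSimplex X 1) (hx : s.vertex 0 = x) (hy : s.vertex 1 = y) :
    edgeWeight φ α x y = Additive.toMul (φ.1 (QBarChain.mk (FreeAbelianGroup.of s))) := by
  rw [edgeWeight, edgeClass_eq _ s hx hy]

/-- The diagonal condition holds because an edge from `x` to `x` is degenerate. For a triangle with
vertices `x`, `y`, `z` the boundary is `[x, z] - [x ▷ y, z] - [x, y] + [x ▷ z, y ▷ z]`, and the
vanishing of `φ` on it is the cocycle identity. -/
theorem edgeWeight_isQuandleCocycle (φ : QCocycle X A 1) (α : ZerothHomotopy X) :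
    IsQuandleCocycle (edgeWeight φ α) where
  diag x := by
    obtain ⟨s, h₀, h₁⟩ := exists_simplex_of_joined (x.joined x)
    rw [edgeWeight_eq φ s h₀ h₁]
    have : (QBarChain.mk (FreeAbelianGroup.of s) : QBarChain X 1) = 0 :=
      (QuotientAddGroup.eq_zero_iff _).2
        (AddSubgroup.subset_closure (Or.inr ⟨s, ⟨0, h₀.trans h₁.symm⟩, rfl⟩))
    rw [this, map_zero]
    rfl
  cocycle x y z := by
    obtain ⟨s, h₀, h₁, h₂⟩ := exists_triangle_of_joined (x.joined y) (y.joined z)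
    have hφ : φ.1 (QBarChain.mk (qBoundary X 1 (FreeAbelianGroup.of s))) = 0 := φ.2 _
    simp only [qBoundary, FreeAbelianGroup.lift_apply_of, map_sum, map_sub, map_zsmul] at hφ
    rw [Fin.sum_univ_two] at hφ
    have hop : ∀ (s t : SingularSimplex X 1) i, (s.op t).vertex i = qop (s.vertex i) (t.vertex i) :=
      fun _ _ _ => rfl
    have hface : ∀ j i, (s.face j).vertex i = s.vertex (j.succAbove i) :=
      fun j i => s.vertex_reindex _ i
    have hact : ∀ j (i : Fin 2), (s.actingFace j).vertex i =
        s.vertex (if i.castSucc < j then j else i.succ) := fun j i => s.vertex_reindex _ i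
    -- The acting faces are `[y, z]` for vertex `1` and `[z, z]` for vertex `2`; in the former case
    -- the second endpoint is `z ▷ z = z`.
    rw [edgeWeight_eq φ (x := x) (y := z) (s.face 1) ((hface 1 0).trans h₀)
        ((hface 1 1).trans h₂),
      edgeWeight_eq φ (x := qop x z) (y := qop y z) ((s.face 2).op (s.actingFace 2))
        (by rw [hop, hface, hact, coe_qop]; exact congrArg₂ qop h₀ h₂)
        (by rw [hop, hface, hact, coe_qop]; exact congrArg₂ qop h₁ h₂),
      edgeWeight_eq φ (x := qop x y) (y := z) ((s.face 1).op (s.actingFace 1))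
        (by rw [hop, hface, hact, coe_qop]; exact congrArg₂ qop h₀ h₁)
        (by rw [hop, hface, hact]; exact (congrArg₂ qop h₂ h₂).trans (qop_self _)),
      edgeWeight_eq φ (x := x) (y := y) (s.face 2) ((hface 2 0).trans h₀)
        ((hface 2 1).trans h₁)]
    simp only [Fin.val_zero, Fin.val_one, pow_zero, pow_one, one_smul, neg_smul] at hφ
    refine Additive.ofMul.injective ?_
    rw [ofMul_mul, ofMul_mul, ofMul_toMul, ofMul_toMul, ofMul_toMul, ofMul_toMul, ← sub_eq_zero,
      ← hφ]
    have key : ∀ a b c d : Additive A, a + b - (c + d) = a - c + -(d - b) := fun a b c d => by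
      abel
    exact key _ _ _ _

end PathComponent

/-! ### Colorings by a path component as colorings of the wiring -/

namespace GaussDiagram

variable {X A : Type*} [TopologicalSpace X] [Quandle X] [IsTopologicalQuandle X] [CommGroup A]

/-- The colorings of a diagram by a path component are the colorings of its wiring. -/
theorem finsum_coloring_eq (φ : QCocycle X A 1) (D : GaussDiagram) (α : ZerothHomotopy X) :
    ∑ᶠ C : D.Coloring α, MonoidAlgebra.of ℤ A (∏ c : D.Crossing, C.weight φ c) =
      D.wiring.stateSum (edgeWeight φ α) := by
  refine finsum_eq_of_biUnique
    (fun C κ => ∀ e, Sum.elim C.color C.loopColor e = (κ.1 e).1) ?_ ?_ ?_ ?_ ?_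
  · intro C
    refine ⟨⟨fun e => ⟨Sum.elim C.color C.loopColor e, ?_⟩, fun c => ⟨?_, ?_⟩⟩, fun e => rfl⟩
    · exact e.casesOn C.color_mem C.loopColor_mem
    · exact Subtype.ext (C.over_eq c)
    · obtain hs | hs := Int.units_eq_one_or (D.sign c)
      · exact (if_pos hs).mpr (Subtype.ext (C.under_pos c hs))
      · exact (if_neg fun h : D.sign c = 1 => absurd (h.symm.trans hs) (by decide)).mpr
          (Subtype.ext (C.under_neg c hs))
  · rintro ⟨κ, hκ⟩
    refine ⟨⟨fun v => (κ (Sum.inl v)).1, fun i => (κ (Sum.inr i)).1, fun v => (κ _).2,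
      fun i => (κ _).2, fun c => congrArg Subtype.val (hκ c).1, fun c hs => ?_, fun c hs => ?_⟩, ?_⟩
    · exact congrArg Subtype.val ((if_pos hs).mp (hκ c).2)
    · exact congrArg Subtype.val
        ((if_neg fun h : D.sign c = 1 => absurd (h.symm.trans hs) (by decide)).mp (hκ c).2)
    · rintro (v | i) <;> rfl
  · intro C κ₁ κ₂ h₁ h₂
    exact Subtype.ext (funext fun e => Subtype.ext ((h₁ e).symm.trans (h₂ e)))
  · intro C₁ C₂ κ h₁ h₂
    have hc : C₁.color = C₂.color :=
      funext fun v => (h₁ (Sum.inl v)).trans (h₂ (Sum.inl v)).symm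
    have hl : C₁.loopColor = C₂.loopColor :=
      funext fun i => (h₁ (Sum.inr i)).trans (h₂ (Sum.inr i)).symm
    cases C₁
    cases C₂
    cases hc
    cases hl
    rfl
  · intro C κ h
    congr 1
    refine Finset.prod_congr rfl fun c _ => ?_
    have hcol : ∀ v, C.color v = (κ.1 (Sum.inl v)).1 := fun v => h (Sum.inl v)
    -- The edge class depends on a proof that its endpoints are joined, so the endpoints are
    -- generalized before they are identified.
    have hedge : ∀ {x y : X} (hxy : Joined x y) (p q : PathComponentPoint α), x = p.1 → y = q.1 →
        Additive.toMul (φ.1 (edgeClass hxy)) = edgeWeight φ α p q := by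
      rintro _ _ _ p q rfl rfl
      rfl
    rw [Coloring.weight, Wiring.weight]
    congr 1
    refine hedge _ _ _ ?_ (hcol _)
    rw [Coloring.sourceColor, hcol, underSource]
    change (κ.1 (Sum.inl (ite (D.sign c = 1) _ _))).1 =
      (ite (D.sign c = 1) _ _ : PathComponentPoint α).1
    split_ifs <;> rfl

end GaussDiagram

/-! ### Invariance of the state sum -/

theorem LinkDiagram.Move.wiring_stateSum_eq {Y A : Type*} [Quandle Y] [CommGroup A]
    {w : Y → Y → A} (hw : IsQuandleCocycle w) {D D' : LinkDiagram} (h : LinkDiagram.Move D D') :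
    D.wiring.stateSum w = D'.wiring.stateSum w := by
  cases h with
  | relabeling h => exact h.stateSum_eq w
  | reidemeister₁ h => exact h.stateSum_eq hw
  | reidemeister₂ h => exact h.stateSum_eq
  | reidemeister₃ h => exact h.stateSum_eq hw

theorem mainTheorem10 {X A : Type*} [Finite X] [TopologicalSpace X] [Quandle X]
    [IsTopologicalQuandle X] [CommGroup A] (φ : QCocycle X A 1)
    (D D' : LinkDiagram) (h : LinkDiagram.SameLink D D') :
    stateSum φ D = stateSum φ D' := by
  -- The path components contribute separately, each with its own quandle and cocycle, so invariance
  -- can be checked component by component.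
  have hsum : ∀ D : LinkDiagram, stateSum φ D =
      ∑ᶠ α : ZerothHomotopy X, D.wiring.stateSum (edgeWeight φ α) := fun D =>
    finsum_congr fun α => GaussDiagram.finsum_coloring_eq φ D.toGaussDiagram α
  induction h with
  | rel D D' h =>
    rw [hsum, hsum]
    exact finsum_congr fun α => h.wiring_stateSum_eq (edgeWeight_isQuandleCocycle φ α)
  | refl => rfl
  | symm _ _ _ ih => exact ih.symm
  | trans _ _ _ _ _ ih₁ ih₂ => exact ih₁.trans ih₂
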